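/- Let $l\ge 0$, let $n_1,\dots,n_l$ be positive integers, put $n=n_1+\cdots+n_l$, and let $P=\prod_{i=1}^l\Delta^{n_i}$, where $\Delta^{k}$ is the $k$-simplex. A small cover over $P$ is a smooth closed $n$-manifold $M$ with a locally standard action of $\mathbb{Z}_2^n$ (every point has an invariant open neighbourhood that is diffeomorphic, equivariantly up to an automorphism of $\mathbb{Z}_2^n$, to an invariant open subset of $\mathbb{R}^n$ with the action by sign changes of the coordinates), together with a map $\pi\colon M\to P$ that induces a homeomorphism $M/\mathbb{Z}_2^n\to P$ compatible with the face structures (a point of $M$ whose isotropy group has order $2^k$ is mapped to a point lying on exactly $k$ facets of $P$). Two small covers $\pi_1\colon M_1\to P$ and $\pi_2\colon M_2\to P$ are Davis–Januszkiewicz (D-J) equivalent if there are an automorphism $\varphi$ of $\mathbb{Z}_2^n$ and a homeomorphism $f\colon M_1\to M_2$ with $f(t\cdot x)=\varphi(t)\cdot f(x)$ for all $t\in\mathbb{Z}_2^n$, $x\in M_1$, and $\pi_2\circ f=\pi_1$. Then the number of D-J equivalence classes of small covers over $P$ is finite and equals $$\sum_{G\in\mathcal{G}_l}\ \prod_{i=1}^l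 (2^{n_i}-1)^{\operatorname{outdeg}_G(v_i)},$$ where $\mathcal{G}_l$ is the set of acyclic digraphs with labeled nodes $v_1,\dots,v_l$ (at most one edge from each node to each node, and no directed cycle of any length, loops included), and $\operatorname{outdeg}_G(v_i)$ is the number of edges of $G$ that start at $v_i$. -/

import Mathlib

open scoped ContDiff

/-- The group `ℤ₂^d`, written additively. -/
abbrev ZTwoPow (d : ℕ) : Type := Fin d → ZMod 2

/-- The standard representation of `ℤ₂^d` on `ℝ^d`: the `i`-th generator changes the sign of the
`i`-th coordinate. -/
def standardAct {d : ℕ} (t : ZTwoPow d) (v : EuclideanSpace ℝ (Fin d)) :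
    EuclideanSpace ℝ (Fin d) :=
  WithLp.toLp 2 (fun i => if t i = 0 then v i else -(v i))

/-- A small cover over a `d`-dimensional simple polytope `P` whose facets are `F j`, `j : ι`:
a smooth closed `d`-manifold with a locally standard action of `ℤ₂^d` whose orbit space is `P`.
The carrier is a compact Hausdorff smooth manifold without boundary. -/
structure SmallCover (d : ℕ) {P : Type} [TopologicalSpace P] {ι : Type} (F : ι → Set P) where
  /-- the underlying manifold -/
  carrier : Type
  [topologicalSpace : TopologicalSpace carrier]
  [t2Space : T2Space carrier]
  [compactSpace : CompactSpace carrier]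
  [chartedSpace : ChartedSpace (EuclideanSpace ℝ (Fin d)) carrier]
  [isManifold : IsManifold (modelWithCornersSelf ℝ (EuclideanSpace ℝ (Fin d))) ∞ carrier]
  [addAction : AddAction (ZTwoPow d) carrier]
  /-- The action is locally standard: every point has an invariant open neighbourhood with a
  diffeomorphism onto an open subset of `ℝ^d` (a member of the maximal smooth atlas) which is
  equivariant up to an automorphism `θ` of `ℤ₂^d`. In particular, the action is smooth. -/
  locallyStandard : ∀ x : carrier,
    ∃ (θ : ZTwoPow d ≃+ ZTwoPow d)
      (e : OpenPartialHomeomorph carrier (EuclideanSpace ℝ (Fin d))),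
      e ∈ IsManifold.maximalAtlas
        (modelWithCornersSelf ℝ (EuclideanSpace ℝ (Fin d))) ∞ carrier ∧
      x ∈ e.source ∧
      ∀ (t : ZTwoPow d), ∀ y ∈ e.source,
        t +ᵥ y ∈ e.source ∧ e (t +ᵥ y) = standardAct (θ t) (e y)
  /-- the projection onto the orbit space `P` -/
  proj : carrier → P
  /-- `proj` is a quotient map whose fibres are the orbits, so that it induces a homeomorphism
  from the orbit space onto `P`. -/
  isQuotientMap_proj : Topology.IsQuotientMap proj
  proj_eq_proj_iff : ∀ x y : carrier, proj x = proj y ↔ ∃ t : ZTwoPow d, t +ᵥ x = y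
  /-- The identification of the orbit space with `P` respects the face structures: an orbit
  whose isotropy group has rank `k` (a point of depth `k` of the orbit space) is a point in the
  relative interior of a face of codimension `k`, i.e. a point on exactly `k` facets. -/
  card_stabilizer : ∀ x : carrier,
    Nat.card (AddAction.stabilizer (ZTwoPow d) x) = 2 ^ Set.ncard {j : ι | proj x ∈ F j}

namespace SmallCover

attribute [instance] SmallCover.topologicalSpace SmallCover.t2Space SmallCover.compactSpace
  SmallCover.chartedSpace SmallCover.isManifold SmallCover.addAction

/-- Davis–Januszkiewicz equivalence: a homeomorphism which is equivariant up to an automorphism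
of `ℤ₂^d` and covers the identity of `P`. -/
def DJEquiv {d : ℕ} {P : Type} [TopologicalSpace P] {ι : Type} {F : ι → Set P}
    (M N : SmallCover d F) : Prop :=
  ∃ (φ : ZTwoPow d ≃+ ZTwoPow d) (f : M.carrier ≃ₜ N.carrier),
    (∀ (t : ZTwoPow d) (x : M.carrier), f (t +ᵥ x) = φ t +ᵥ f x) ∧
      ∀ x : M.carrier, N.proj (f x) = M.proj x

/-- D-J equivalence as an equivalence relation on the small covers over `P`. -/
def djSetoid (d : ℕ) {P : Type} [TopologicalSpace P] {ι : Type} (F : ι → Set P) :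
    Setoid (SmallCover d F) where
  r := DJEquiv
  iseqv :=
    { refl := fun M => ⟨AddEquiv.refl _, Homeomorph.refl _, fun _ _ => rfl, fun _ => rfl⟩
      symm := by
        rintro M N ⟨φ, f, hf, hp⟩
        refine ⟨φ.symm, f.symm, fun t x => ?_, fun x => ?_⟩
        · apply f.injective
          rw [hf]
          simp
        · rw [← hp]
          simp
      trans := by
        rintro M N K ⟨φ, f, hf, hp⟩ ⟨ψ, g, hg, hq⟩
        refine ⟨φ.trans ψ, f.trans g, fun t x => ?_, fun x => ?_⟩
        · simp [hf, hg]
        · simp [hp, hq] }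

end SmallCover

/-- The number of D-J equivalence classes of small covers over `P`. -/
noncomputable def numDJClasses (d : ℕ) {P : Type} [TopologicalSpace P] {ι : Type}
    (F : ι → Set P) : ℕ :=
  Nat.card (Quotient (SmallCover.djSetoid d F))

/-- The product of simplices `∏ i, Δ^{n i}`. -/
abbrev SimplexProd {l : ℕ} (n : Fin l → ℕ) : Type :=
  ∀ i : Fin l, stdSimplex ℝ (Fin (n i + 1))

/-- The facets of `∏ i, Δ^{n i}` (all `n i` positive): for each `i` and `0 ≤ k ≤ n i`, the
product of the facet of `Δ^{n i}` where the `k`-th barycentric coordinate vanishes with the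
remaining simplices. -/
def simplexProdFacet {l : ℕ} (n : Fin l → ℕ) (j : Σ i : Fin l, Fin (n i + 1)) :
    Set (SimplexProd n) :=
  {p | (p j.1).1 j.2 = 0}

/-- A digraph is acyclic if it has no directed cycle of any length (so in particular no loop and
no pair of opposite edges). -/
def Digraph.IsAcyclic {V : Type} (G : Digraph V) : Prop :=
  ∀ v : V, ¬ Relation.TransGen G.Adj v v

/-- The number of edges of a digraph that start at `v`. -/
noncomputable def Digraph.outdeg {V : Type} (G : Digraph V) (v : V) : ℕ :=
  Set.ncard {w : V | G.Adj v w}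

open Classical in
/-- The finite set of acyclic digraphs with labeled nodes `0, …, l - 1`. -/
noncomputable def acyclicDigraphs (l : ℕ) : Finset (Digraph (Fin l)) :=
  Finset.univ.filter fun G => G.IsAcyclic

/-! A small cover is determined up to D-J equivalence by its characteristic function `lam`, which
sends each facet to the nonzero element fixing the points over its relative interior, modulo
automorphisms of the group. In standard charts every isotropy group is generated by the values at
the facets through the point, and by its order these values are independent. The map to the polytope
has a continuous section: the action is free over the contractible interior, so a section exists
there, and it extends to the boundary by limits. Matching isotropy groups then glue sections to
equivariant homeomorphisms (`djEquiv_of_stabilizer`).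

The facets with nonzero indices meet in one vertex, so their values form a basis. Expanding the
remaining values `lam i 0` in it gives a block matrix `A`, a complete invariant (`HasMatrix.unique`,
`HasMatrix.djEquiv`). Independence at a vertex `v` says that no nontrivial combination of the
relations vanishes at all positions `v j`. For all vertices together this amounts to all-ones
diagonal blocks and an acyclic digraph of nonzero off-diagonal blocks
(`isUnitriangular_of_forall_sum_ne_zero`, `IsUnitriangular.eq_zero_of_rows`). Each such matrix is
realized by a quotient of a product of spheres by a group of sign changes (`smallCover`).

For a fixed acyclic digraph, each edge starting at `j` carries one of `2 ^ n j - 1` nonzero blocks;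
this gives the formula. -/

/-! ### Block matrices with acyclic digraph and their number. -/

/-- Matrices over `ZMod 2` with `l` rows whose `j`-th column is a block of `n j` columns. -/
abbrev BlockMatrix {l : ℕ} (n : Fin l → ℕ) : Type := ∀ _ j : Fin l, Fin (n j) → ZMod 2

namespace BlockMatrix

variable {l : ℕ} {n : Fin l → ℕ}

/-- The digraph of the nonzero off-diagonal blocks. -/
def digraph (A : BlockMatrix n) : Digraph (Fin l) := ⟨fun j i => j ≠ i ∧ A i j ≠ 0⟩

/-- The diagonal blocks consist of ones and the digraph of the other blocks is acyclic. -/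
def IsUnitriangular (A : BlockMatrix n) : Prop := (∀ i, A i i = 1) ∧ A.digraph.IsAcyclic

end BlockMatrix

theorem ZMod.two_eq_one_of_ne_zero {a : ZMod 2} (h : a ≠ 0) : a = 1 := by
  revert a; decide

theorem Digraph.IsAcyclic.exists_sink {V : Type} [Finite V] {G : Digraph V} (hG : G.IsAcyclic)
    {S : Set V} (hS : S.Nonempty) : ∃ j ∈ S, ∀ i ∈ S, ¬ G.Adj j i := by
  let r : V → V → Prop := fun a b => Relation.TransGen G.Adj b a
  have : IsTrans V r := ⟨fun _ _ _ h₁ h₂ => h₂.trans h₁⟩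
  have : Std.Irrefl r := ⟨hG⟩
  obtain ⟨m, hm, h⟩ := (Finite.wellFounded_of_trans_of_irrefl r).has_min S hS
  exact ⟨m, hm, fun i hi hmi => h i hi (.single hmi)⟩

namespace BlockMatrix

variable {l : ℕ} {n : Fin l → ℕ}

/-- Singletons `S` give the diagonal. If there were a cycle, a minimal nonempty set without a sink
would be a disjoint union of chordless cycles; choosing in each block a column that shows the cycle
edge makes every column sum equal to `1 + 1 = 0`. -/
theorem isUnitriangular_of_forall_sum_ne_zero (hn : ∀ i, 1 ≤ n i) (A : BlockMatrix n)
    (h : ∀ S : Finset (Fin l), S.Nonempty → ∀ k : ∀ j, Fin (n j),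
      ∃ j ∈ S, ∑ i ∈ S, A i j (k j) ≠ 0) : A.IsUnitriangular := by
  classical
  have hdiag : ∀ i, A i i = 1 := by
    intro i
    funext k
    obtain ⟨j, hj, hne⟩ := h {i} (Finset.singleton_nonempty i)
      (Function.update (fun j => ⟨0, hn j⟩) i k)
    obtain rfl := Finset.mem_singleton.1 hj
    simp only [Finset.sum_singleton, Function.update_self] at hne
    exact ZMod.two_eq_one_of_ne_zero hne
  refine ⟨hdiag, fun v hv => ?_⟩
  set G := A.digraph with hGdef
  let Q : Finset (Fin l) → Prop := fun S => S.Nonempty ∧ ∀ j ∈ S, ∃ i ∈ S, G.Adj j i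
  have hQ : ∃ S, Q S := by
    refine ⟨Finset.univ.filter fun x => Relation.TransGen G.Adj v x ∧ Relation.TransGen G.Adj x v,
      ⟨v, by simpa using hv⟩, fun x hx => ?_⟩
    simp only [Finset.mem_filter, Finset.mem_univ, true_and] at hx ⊢
    obtain ⟨y, hxy, hyv⟩ := Relation.TransGen.head'_iff.1 hx.2
    exact ⟨y, ⟨hx.1.tail hxy, Relation.TransGen.trans_right hyv hv⟩, hxy⟩
  obtain ⟨S, hS, hmin⟩ := WellFounded.has_min (wellFounded_lt (α := Finset (Fin l))) {S | Q S} hQ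
  -- The image of a successor map on `S` again has no sink, so minimality forces it to be all of
  -- `S`.
  have himage : ∀ f : Fin l → Fin l, (∀ j ∈ S, f j ∈ S ∧ G.Adj j (f j)) → S.image f = S := by
    intro f hf
    have hsub : S.image f ⊆ S := Finset.image_subset_iff.2 fun j hj => (hf j hj).1
    by_contra hne
    refine hmin (S.image f) ⟨hS.1.image f, fun x hx => ?_⟩ (hsub.ssubset_of_ne hne)
    have hxS := hsub hx
    exact ⟨f x, Finset.mem_image_of_mem f hxS, (hf x hxS).2⟩
  have hch : ∀ j, ∃ i, j ∈ S → i ∈ S ∧ G.Adj j i := fun j => by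
    by_cases hj : j ∈ S
    · obtain ⟨i, hi⟩ := hS.2 j hj
      exact ⟨i, fun _ => hi⟩
    · exact ⟨j, fun h => absurd h hj⟩
  choose f hf using hch
  have hinj : Set.InjOn f S :=
    Finset.injOn_of_card_image_eq (by rw [himage f hf])
  -- Redirecting `f` at `j` to a second successor would leave `f j` without a preimage, since `f` is
  -- injective on `S`.
  have huniq : ∀ j ∈ S, ∀ i ∈ S, G.Adj j i → i = f j := by
    intro j hj i hi hji
    by_contra hne
    have himg := himage (Function.update f j i) (fun x hx => by
      by_cases hxj : x = j
      · subst hxj; simpa using ⟨hi, hji⟩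
      · simpa [Function.update_of_ne hxj] using hf x hx)
    have hmem := (hf j hj).1
    rw [← himg, Finset.mem_image] at hmem
    obtain ⟨x, hx, hxf⟩ := hmem
    by_cases hxj : x = j
    · subst hxj
      rw [Function.update_self] at hxf
      exact hne hxf
    · rw [Function.update_of_ne hxj] at hxf
      exact hxj (hinj hx hj hxf)
  have hk : ∀ j, ∃ k : Fin (n j), j ∈ S → A (f j) j k ≠ 0 := fun j => by
    by_cases hj : j ∈ S
    · obtain ⟨k, hk⟩ := Function.ne_iff.1 (hf j hj).2.2
      exact ⟨k, fun _ => hk⟩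
    · exact ⟨⟨0, hn j⟩, fun h => absurd h hj⟩
  choose k hk using hk
  obtain ⟨j, hj, hne⟩ := h S hS.1 k
  apply hne
  have hjf : j ≠ f j := (hf j hj).2.1
  -- Only the diagonal entry and the entry of the edge to `f j` survive in column `k j`.
  rw [← Finset.sum_subset (s₁ := {j, f j}) (by simp [Finset.insert_subset_iff, hj, (hf j hj).1]),
    Finset.sum_pair hjf, hdiag, ZMod.two_eq_one_of_ne_zero (hk j hj)]
  · exact CharTwo.add_self_eq_zero (1 : ZMod 2)
  · intro i hi hni
    simp only [Finset.mem_insert, Finset.mem_singleton, not_or] at hni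
    by_contra hA
    exact hni.2 (huniq j hj i hi ⟨fun h => hni.1 h.symm, fun h => hA (by rw [h]; rfl)⟩)

open Classical in
theorem card_isUnitriangular (n : Fin l → ℕ) :
    Nat.card {A : BlockMatrix n // A.IsUnitriangular} =
      ∑ G ∈ acyclicDigraphs l, ∏ i, (2 ^ n i - 1) ^ G.outdeg i := by
  rw [Nat.card_eq_fintype_card, Fintype.card_subtype,
    Finset.card_eq_sum_card_fiberwise (f := digraph) (t := acyclicDigraphs l)
      (fun A hA => by
        have := (Finset.mem_filter.1 hA).2
        simpa [acyclicDigraphs] using this.2)]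
  refine Finset.sum_congr rfl fun G hG => ?_
  have hGa : G.IsAcyclic := by simpa [acyclicDigraphs] using hG
  have hloop : ∀ i, ¬ G.Adj i i := fun i h => hGa i (.single h)
  -- The fibre over `G` is a box: every block is chosen independently from a set that depends only
  -- on its position.
  have hfib : (Finset.univ.filter fun A : BlockMatrix n => A.IsUnitriangular).filter
      (fun A => A.digraph = G) = Fintype.piFinset fun i => Fintype.piFinset fun j =>
        if i = j then ({1} : Finset (Fin (n j) → ZMod 2))
        else if G.Adj j i then Finset.univ.erase 0 else {0} := by
    ext A
    simp only [Finset.mem_filter, Finset.mem_univ, true_and, Fintype.mem_piFinset]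
    constructor
    · rintro ⟨⟨hd, -⟩, rfl⟩ i j
      split_ifs with hij hadj
      · subst hij; simp [hd]
      · simpa using hadj.2
      · by_contra hne
        exact hadj ⟨fun h => hij h.symm, by simpa using hne⟩
    · intro h
      have hd : ∀ i, A i i = 1 := fun i => by simpa using h i i
      have hAG : A.digraph = G := by
        ext j i
        have hji := h i j
        change j ≠ i ∧ A i j ≠ 0 ↔ _
        by_cases hij : i = j
        · subst hij; simp [hloop]
        · rw [if_neg hij] at hji
          by_cases hadj : G.Adj j i
          · rw [if_pos hadj] at hji
            simp only [hadj, iff_true]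
            exact ⟨fun h => hij h.symm, by simpa using hji⟩
          · rw [if_neg hadj] at hji
            simp [hadj, Finset.mem_singleton.1 hji]
      exact ⟨⟨hd, hAG ▸ hGa⟩, hAG⟩
  rw [hfib, Fintype.card_piFinset]
  simp only [Fintype.card_piFinset]
  -- The length of a block is that of its column index, the source of the edge, so the product is
  -- grouped by sources.
  rw [Finset.prod_comm]
  refine Finset.prod_congr rfl fun j _ => ?_
  have hcard : ∀ i, (if i = j then ({1} : Finset (Fin (n j) → ZMod 2))
      else if G.Adj j i then Finset.univ.erase 0 else {0}).card =
        if G.Adj j i then 2 ^ n j - 1 else 1 := by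
    intro i
    by_cases hij : i = j
    · subst hij; simp [hloop]
    · rw [if_neg hij]
      split_ifs
      · rw [Finset.card_erase_of_mem (Finset.mem_univ _), Finset.card_univ]
        simp [ZMod.card]
      · simp
  simp only [hcard]
  rw [Finset.prod_ite, Finset.prod_const_one, mul_one, Finset.prod_const]
  congr 1
  rw [Digraph.outdeg, ← Set.ncard_coe_finset]
  simp

end BlockMatrix

/-! ### Relative interiors of faces of a product of simplices. -/

namespace SimplexProd

open Topology Set

variable {l : ℕ} {n : Fin l → ℕ}

/-- The inclusion of a product of simplices in the ambient vector space. -/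
def incl (p : SimplexProd n) : ∀ i, Fin (n i + 1) → ℝ := fun i => (p i).1

theorem isEmbedding_incl : IsEmbedding (incl : SimplexProd n → _) := by
  refine ⟨⟨?_⟩, fun p q h => funext fun i => Subtype.ext (congrFun h i)⟩
  simp only [Pi.topologicalSpace, instTopologicalSpaceSubtype, induced_iInf, induced_compose]
  rfl

theorem incl_nonneg (p : SimplexProd n) (i k) : 0 ≤ incl p i k := (p i).2.1 k

theorem sum_incl (p : SimplexProd n) (i) : ∑ k, incl p i k = 1 := (p i).2.2

theorem convex_range_incl : Convex ℝ (range (incl : SimplexProd n → _)) := by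
  have : range (incl : SimplexProd n → _) = Set.pi univ fun i => stdSimplex ℝ (Fin (n i + 1)) := by
    ext z
    constructor
    · rintro ⟨p, rfl⟩ i -
      exact (p i).2
    · intro h
      exact ⟨fun i => ⟨z i, h i trivial⟩, rfl⟩
  rw [this]
  exact convex_pi fun i _ => convex_stdSimplex ℝ _

theorem isPreconnected_preimage_incl {S : Set (∀ i, Fin (n i + 1) → ℝ)} (hS : Convex ℝ S) :
    IsPreconnected (incl ⁻¹' S : Set (SimplexProd n)) := by
  rw [← isEmbedding_incl.isInducing.isPreconnected_image, image_preimage_eq_inter_range]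
  exact (hS.inter convex_range_incl).isPreconnected

/-- The set of points that lie on the facets in `S` and on no other facets. -/
def cell (S : Set (Σ i : Fin l, Fin (n i + 1))) : Set (SimplexProd n) :=
  {p | ∀ i k, incl p i k = 0 ↔ ⟨i, k⟩ ∈ S}

theorem exists_convex_cell_eq (S : Set (Σ i : Fin l, Fin (n i + 1))) :
    ∃ K : Set (∀ i, Fin (n i + 1) → ℝ), Convex ℝ K ∧ (cell S : Set (SimplexProd n)) = incl ⁻¹' K := by
  refine ⟨{z | ∀ i k, (⟨i, k⟩ ∈ S → z i k = 0) ∧ (⟨i, k⟩ ∉ S → 0 < z i k)}, ?_, ?_⟩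
  · intro x hx y hy a b ha hb hab i k
    refine ⟨fun h => ?_, fun h => ?_⟩
    · simp [(hx i k).1 h, (hy i k).1 h]
    · exact convex_Ioi (0 : ℝ) ((hx i k).2 h) ((hy i k).2 h) ha hb hab
  · ext p
    simp only [cell, mem_ofPred_eq, mem_preimage]
    refine forall_congr' fun i => forall_congr' fun k => ?_
    have := incl_nonneg p i k
    constructor
    · intro h
      exact ⟨h.2, fun h' => lt_of_le_of_ne this fun h0 => h' (h.1 h0.symm)⟩
    · rintro ⟨h₁, h₂⟩
      refine ⟨fun h0 => ?_, h₁⟩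
      by_contra h
      exact (h₂ h).ne' h0

theorem isPreconnected_cell (S : Set (Σ i : Fin l, Fin (n i + 1))) :
    IsPreconnected (cell S : Set (SimplexProd n)) := by
  obtain ⟨K, hK, h⟩ := exists_convex_cell_eq (n := n) S
  rw [h]
  exact isPreconnected_preimage_incl hK

/-- Small neighbourhoods whose intersection with the relative interior of a face is connected. -/
theorem exists_mem_nhds_isPreconnected_inter_cell (S : Set (Σ i : Fin l, Fin (n i + 1)))
    {p : SimplexProd n} {U : Set (SimplexProd n)} (hU : U ∈ 𝓝 p) :
    ∃ V ∈ 𝓝 p, V ⊆ U ∧ IsPreconnected (V ∩ cell S) := by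
  rw [isEmbedding_incl.nhds_eq_comap, Filter.mem_comap] at hU
  obtain ⟨U', hU', hUU⟩ := hU
  obtain ⟨r, hr, hball⟩ := Metric.mem_nhds_iff.1 hU'
  obtain ⟨K, hK, h⟩ := exists_convex_cell_eq (n := n) S
  refine ⟨incl ⁻¹' Metric.ball (incl p) r,
    isEmbedding_incl.continuous.continuousAt (Metric.ball_mem_nhds _ hr),
    (preimage_mono hball).trans hUU, ?_⟩
  rw [h, ← preimage_inter]
  exact isPreconnected_preimage_incl ((convex_ball _ _).inter hK)

/-- Convex combination of two points of a product of simplices. -/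
def comb (t : unitInterval) (p q : SimplexProd n) : SimplexProd n := fun i =>
  ⟨(1 - t : ℝ) • (p i).1 + (t : ℝ) • (q i).1,
    convex_stdSimplex ℝ _ (p i).2 (q i).2 (sub_nonneg.2 t.2.2) t.2.1 (by ring)⟩

theorem incl_comb (t : unitInterval) (p q : SimplexProd n) (i k) :
    incl (comb t p q) i k = (1 - t) * incl p i k + t * incl q i k := rfl

@[simp] theorem comb_zero (p q : SimplexProd n) : comb 0 p q = p := by
  refine isEmbedding_incl.injective ?_
  funext i k; simp [incl_comb]

@[simp] theorem comb_one (p q : SimplexProd n) : comb 1 p q = q := by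
  refine isEmbedding_incl.injective ?_
  funext i k; simp [incl_comb]

theorem continuous_incl_apply (i k) : Continuous fun p : SimplexProd n => incl p i k :=
  (continuous_apply k).comp ((continuous_apply i).comp isEmbedding_incl.continuous)

theorem continuous_comb {X : Type*} [TopologicalSpace X] {t : X → unitInterval}
    {p q : X → SimplexProd n} (ht : Continuous t) (hp : Continuous p) (hq : Continuous q) :
    Continuous fun x => comb (t x) (p x) (q x) := by
  rw [isEmbedding_incl.continuous_iff]
  refine continuous_pi fun i => continuous_pi fun k => ?_
  have h₁ := (continuous_incl_apply i k).comp hp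
  have h₂ := (continuous_incl_apply i k).comp hq
  simp only [Function.comp_def, incl_comb] at *
  fun_prop

theorem comb_mem_cell {S : Set (Σ i : Fin l, Fin (n i + 1))} {p q : SimplexProd n}
    (hp : ∀ i k, ⟨i, k⟩ ∈ S → incl p i k = 0) (hq : q ∈ cell S) {t : unitInterval} (ht : t ≠ 0) :
    comb t p q ∈ cell S := by
  intro i k
  have ht' : (0 : ℝ) < t := lt_of_le_of_ne t.2.1 fun h => ht (Subtype.ext h.symm)
  rw [incl_comb]
  constructor
  · intro h
    rw [← hq i k]
    have h₁ := mul_nonneg (sub_nonneg.2 t.2.2) (incl_nonneg p i k)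
    have h₂ := mul_nonneg t.2.1 (incl_nonneg q i k)
    exact (mul_eq_zero.1 (by linarith : (t : ℝ) * incl q i k = 0)).resolve_left ht'.ne'
  · intro h
    simp [hp i k h, (hq i k).2 h]

/-- The segment from `p` to a point of the cell lies in the cell except possibly for its end `p`. -/
theorem mem_closure_cell {S : Set (Σ i : Fin l, Fin (n i + 1))}
    (hS : (cell S : Set (SimplexProd n)).Nonempty) {p : SimplexProd n}
    (hp : ∀ i k, ⟨i, k⟩ ∈ S → incl p i k = 0) : p ∈ closure (cell S) := by
  obtain ⟨q, hq⟩ := hS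
  have hc : Continuous fun t : unitInterval => comb t p q :=
    continuous_comb continuous_id continuous_const continuous_const
  have h0 : (0 : unitInterval) ∈ closure ({0}ᶜ : Set unitInterval) := by
    rw [mem_closure_iff_nhdsWithin_neBot]
    infer_instance
  have := hc.continuousAt.continuousWithinAt.mem_closure (s := {0}ᶜ) (t := cell S) h0
    fun t ht => comb_mem_cell hp hq ht
  simpa using this

/-- The witness is the barycentre of the face: equal weights on the coordinates outside `S`. -/
theorem nonempty_cell {S : Set (Σ i : Fin l, Fin (n i + 1))} (hS : ∀ i, ∃ k, ⟨i, k⟩ ∉ S) :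
    (cell S : Set (SimplexProd n)).Nonempty := by
  classical
  let c : Fin l → ℝ := fun i => ∑ k : Fin (n i + 1), if ⟨i, k⟩ ∈ S then 0 else 1
  have hc : ∀ i, 0 < c i := fun i => by
    obtain ⟨k, hk⟩ := hS i
    refine Finset.sum_pos' (fun k _ => by split_ifs <;> simp) ⟨k, Finset.mem_univ _, by simp [hk]⟩
  refine ⟨fun i => ⟨fun k => (if ⟨i, k⟩ ∈ S then 0 else 1) / c i, fun k => ?_, ?_⟩, fun i k => ?_⟩
  · exact div_nonneg (by split_ifs <;> simp) (hc i).le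
  · rw [← Finset.sum_div]
    exact div_self (hc i).ne'
  · simp only [incl, div_eq_zero_iff, (hc i).ne', or_false]
    split_ifs with h <;> simp [h]

theorem nonempty_cell_empty : (cell ∅ : Set (SimplexProd n)).Nonempty :=
  nonempty_cell fun _ => ⟨0, id⟩

/-- Positivity of `n i` matters here: a zero-dimensional factor would have an empty facet. -/
theorem nonempty_cell_singleton (hn : ∀ i, 1 ≤ n i) (j : Σ i : Fin l, Fin (n i + 1)) :
    (cell {j} : Set (SimplexProd n)).Nonempty := by
  refine nonempty_cell fun i => ?_
  obtain ⟨j, k⟩ := j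
  by_cases h : i = j
  · subst h
    have : Nontrivial (Fin (n i + 1)) := Fin.nontrivial_iff_two_le.2 (by have := hn i; omega)
    obtain ⟨k', hk'⟩ := exists_ne k
    exact ⟨k', by simpa using hk'⟩
  · exact ⟨0, by simp [h]⟩

theorem mem_cell_iff {S : Set (Σ i : Fin l, Fin (n i + 1))} {p : SimplexProd n} :
    p ∈ cell S ↔ {j | p ∈ simplexProdFacet n j} = S := by
  constructor
  · rintro h
    ext ⟨i, k⟩
    exact h i k
  · rintro rfl i k
    rfl

end SimplexProd

/-! ### Sections over the interior of the polytope. -/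

namespace SmallCover

open Topology Set

section

variable {d : ℕ} {P : Type} [TopologicalSpace P] {ι : Type} {F : ι → Set P} (M : SmallCover d F)

/-- Continuity of the action is not a field of the structure; it follows because translations are
linear in standard charts. -/
instance continuousConstVAdd : ContinuousConstVAdd (ZTwoPow d) M.carrier where
  continuous_const_vadd t := by
    rw [continuous_iff_continuousAt]
    intro x
    obtain ⟨θ, e, -, hx, he⟩ := M.locallyStandard x
    have hst : Continuous (standardAct (θ t)) := by
      unfold standardAct
      refine (PiLp.continuous_toLp 2 _).comp (continuous_pi fun i => ?_)
      split_ifs <;> fun_prop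
    have hx' := he t x hx
    have h : ContinuousAt (fun y => e.symm (standardAct (θ t) (e y))) x := by
      refine ContinuousAt.comp (g := e.symm) ?_ (hst.continuousAt.comp (e.continuousAt hx))
      exact e.continuousAt_symm (hx'.2 ▸ e.map_source hx'.1)
    refine h.congr ?_
    filter_upwards [e.open_source.mem_nhds hx] with y hy
    rw [← (he t y hy).2, e.left_inv (he t y hy).1]

theorem proj_vadd (t : ZTwoPow d) (x : M.carrier) : M.proj (t +ᵥ x) = M.proj x :=
  ((M.proj_eq_proj_iff x (t +ᵥ x)).2 ⟨t, rfl⟩).symm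

theorem continuous_proj : Continuous M.proj := M.isQuotientMap_proj.continuous

theorem finite_fiber (p : P) : (M.proj ⁻¹' {p}).Finite := by
  obtain ⟨x, rfl⟩ := M.isQuotientMap_proj.surjective p
  refine (Set.finite_range fun t : ZTwoPow d => t +ᵥ x).subset fun y hy => ?_
  obtain ⟨t, ht⟩ := (M.proj_eq_proj_iff x y).1 (Eq.symm hy)
  exact ⟨t, ht⟩

theorem stabilizer_eq_of_proj_eq {x y : M.carrier} (h : M.proj x = M.proj y) :
    AddAction.stabilizer (ZTwoPow d) x = AddAction.stabilizer (ZTwoPow d) y := by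
  obtain ⟨t, rfl⟩ := (M.proj_eq_proj_iff x y).1 h
  ext s
  rw [AddAction.mem_stabilizer_iff, AddAction.mem_stabilizer_iff, vadd_vadd, add_comm, ← vadd_vadd]
  exact (vadd_left_cancel_iff t).symm

theorem stabilizer_eq_bot {x : M.carrier} (h : {j : ι | M.proj x ∈ F j} = ∅) :
    AddAction.stabilizer (ZTwoPow d) x = ⊥ := by
  have := M.card_stabilizer x
  rw [h, Set.ncard_empty, pow_zero] at this
  exact AddSubgroup.eq_bot_of_card_le _ this.le

end

variable {l : ℕ} {n : Fin l → ℕ} {d : ℕ} (M : SmallCover d (simplexProdFacet n))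

/-- Over the interior the isotropy groups are trivial, and a free action of a finite group on a
Hausdorff space gives a covering. -/
theorem isCoveringMapOn_proj : IsCoveringMapOn M.proj (SimplexProd.cell ∅) := by
  refine (M.isQuotientMap_proj.isCoveringMapOn_of_properlyDiscontinuousVAdd
    (G := ZTwoPow d) ?_).mono ?_
  · intro x y
    rw [AddAction.mem_orbit_iff, eq_comm, M.proj_eq_proj_iff]
  · intro p hp
    obtain ⟨x, rfl⟩ := M.isQuotientMap_proj.surjective p
    exact ⟨x, M.stabilizer_eq_bot (SimplexProd.mem_cell_iff.1 hp), rfl⟩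

/-- The straight-line contraction of the interior to `q` is lifted starting from the constant map to
`y`; its end at time `1` is a section. -/
theorem exists_section_interior : ∃ s : SimplexProd n → M.carrier,
    ContinuousOn s (SimplexProd.cell ∅) ∧ ∀ p ∈ (SimplexProd.cell ∅ : Set (SimplexProd n)),
      M.proj (s p) = p := by
  set C : Set (SimplexProd n) := SimplexProd.cell ∅ with hC
  obtain ⟨q, hq⟩ := SimplexProd.nonempty_cell_empty (n := n)
  have cov := M.isCoveringMapOn_proj.isCoveringMap_restrictPreimage
  obtain ⟨y, hy⟩ := M.isQuotientMap_proj.surjective q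
  let H : C(unitInterval × C, C) :=
    ⟨fun x => ⟨SimplexProd.comb x.1 q x.2.1, by
        by_cases h : x.1 = 0
        · rw [h, SimplexProd.comb_zero]; exact hq
        · exact SimplexProd.comb_mem_cell (by simp) x.2.2 h⟩,
      by
        refine Continuous.subtype_mk ?_ _
        exact SimplexProd.continuous_comb continuous_fst continuous_const
          (continuous_subtype_val.comp continuous_snd)⟩
  let f : C(C, M.proj ⁻¹' C) := ContinuousMap.const _ ⟨y, by rw [mem_preimage, hy]; exact hq⟩
  have H0 : ∀ a, H (0, a) = C.restrictPreimage M.proj (f a) := fun a =>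
    Subtype.ext (by simp [H, f, hy])
  have hl := cov.liftHomotopy_lifts H f H0
  classical
  let s : SimplexProd n → M.carrier := fun p =>
    if h : p ∈ C then (cov.liftHomotopy H f H0 (1, ⟨p, h⟩)).1 else y
  refine ⟨s, ?_, ?_⟩
  · rw [continuousOn_iff_continuous_domRestrict]
    have : C.domRestrict s = fun p => (cov.liftHomotopy H f H0 (1, p)).1 := by
      funext p
      exact dif_pos p.2
    rw [this]
    fun_prop
  · intro p hp
    have hs : s p = (cov.liftHomotopy H f H0 (1, ⟨p, hp⟩)).1 := dif_pos hp
    rw [hs]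
    exact (congrArg Subtype.val (congrFun hl (1, ⟨p, hp⟩))).trans (SimplexProd.comb_one q p)

end SmallCover

/-! ### Extension of sections to the boundary, and homeomorphisms from sections. -/

namespace SmallCover

open Topology Set Filter

section

variable {d : ℕ} {P : Type} [TopologicalSpace P] [T2Space P] {ι : Type} {F : ι → Set P}
  (M : SmallCover d F)

theorem isClosedMap_proj : IsClosedMap M.proj := M.continuous_proj.isClosedMap

theorem eventually_mem_of_fiber_subset {p : P} {O : Set M.carrier} (hO : IsOpen O)
    (h : M.proj ⁻¹' {p} ⊆ O) : ∀ᶠ q in 𝓝 p, ∀ x, M.proj x = q → x ∈ O := by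
  have hc := (M.isClosedMap_proj _ hO.isClosed_compl).isOpen_compl
  filter_upwards [hc.mem_nhds (x := p) (by rintro ⟨x, hx, rfl⟩; exact hx (h rfl))] with q hq x hx
  by_contra hxO
  exact hq ⟨x, hxO, hx⟩

/-- A section over a subset which is connected near `p` has a limit at `p`. -/
theorem exists_tendsto_section {C : Set P} {s : P → M.carrier} (hs : ContinuousOn s C)
    (hsp : ∀ p ∈ C, M.proj (s p) = p) {p : P} (hp : p ∈ closure C)
    (hC : ∀ U ∈ 𝓝 p, ∃ V ∈ 𝓝 p, V ⊆ U ∧ IsPreconnected (V ∩ C)) :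
    ∃ y, Tendsto s (𝓝[C] p) (𝓝 y) := by
  -- Disjoint neighbourhoods of the finitely many fibre points contain all fibres near `p`;
  -- connectedness of `V ∩ C` keeps the section in a single one of them.
  obtain ⟨U, hU, hdis⟩ := (M.finite_fiber p).t2_separation
  have hO := M.eventually_mem_of_fiber_subset (p := p)
    (isOpen_biUnion fun y (_ : y ∈ M.proj ⁻¹' {p}) => (hU y).2)
    fun y hy => mem_biUnion hy (hU y).1
  obtain ⟨V, hV, hVU, hVC⟩ := hC _ hO
  obtain ⟨q, hqV, hqC⟩ := mem_closure_iff_nhds.1 hp V hV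
  obtain ⟨y, hy, hqy⟩ := mem_iUnion₂.1 (hVU hqV _ (hsp q hqC))
  have hopen : IsOpen (⋃ z ∈ M.proj ⁻¹' {p} \ {y}, U z) :=
    isOpen_biUnion fun z _ => (hU z).2
  have hdisj : Disjoint (U y) (⋃ z ∈ M.proj ⁻¹' {p} \ {y}, U z) := by
    rw [disjoint_iUnion₂_right]
    exact fun z hz => hdis hy hz.1 fun h => hz.2 h.symm
  have hsub : s '' (V ∩ C) ⊆ U y := by
    refine IsPreconnected.subset_left_of_subset_union (hU y).2 hopen hdisj ?_
      ⟨s q, mem_image_of_mem s ⟨hqV, hqC⟩, hqy⟩ (hVC.image s (hs.mono inter_subset_right))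
    rintro _ ⟨r, ⟨hrV, hrC⟩, rfl⟩
    obtain ⟨z, hz, hrz⟩ := mem_iUnion₂.1 (hVU hrV _ (hsp r hrC))
    by_cases hzy : z = y
    · exact Or.inl (hzy ▸ hrz)
    · exact Or.inr (mem_biUnion (show z ∈ M.proj ⁻¹' {p} \ {y} from ⟨hz, hzy⟩) hrz)
  refine ⟨y, tendsto_def.2 fun W hW => ?_⟩
  obtain ⟨W', hW'W, hW', hyW'⟩ := mem_nhds_iff.1 hW
  -- Shrinking only the neighbourhood of `y` turns confinement to `U y` into convergence to `y`.
  have hO' := M.eventually_mem_of_fiber_subset (p := p) (hW'.union hopen) fun z hz => by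
    by_cases hzy : z = y
    · exact Or.inl (hzy ▸ hyW')
    · exact Or.inr (mem_biUnion (show z ∈ M.proj ⁻¹' {p} \ {y} from ⟨hz, hzy⟩) (hU z).1)
  filter_upwards [mem_nhdsWithin_of_mem_nhds hO', mem_nhdsWithin_of_mem_nhds hV,
    self_mem_nhdsWithin] with r hr hrV hrC
  refine (hr _ (hsp r hrC)).elim (fun h => hW'W h) fun h => ?_
  exact absurd h (disjoint_left.1 hdisj (hsub (mem_image_of_mem s ⟨hrV, hrC⟩)))

end

/-- Sections of two small covers with compatible isotropy groups induce an equivariant map. -/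
theorem exists_continuous_of_section {d : ℕ} {P : Type} [TopologicalSpace P] [CompactSpace P]
    {ι : Type} {F : ι → Set P} {M N : SmallCover d F} {s : P → M.carrier} {s' : P → N.carrier}
    (hs : Continuous s) (hs' : Continuous s') (hsp : ∀ p, M.proj (s p) = p)
    (φ : ZTwoPow d ≃+ ZTwoPow d)
    (h : ∀ p t, t +ᵥ s p = s p → φ t +ᵥ s' p = s' p) :
    ∃ f : M.carrier → N.carrier, Continuous f ∧ ∀ t p, f (t +ᵥ s p) = φ t +ᵥ s' p := by
  have hex : ∀ x, ∃ t : ZTwoPow d, t +ᵥ s (M.proj x) = x := fun x =>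
    (M.proj_eq_proj_iff _ _).1 (hsp _)
  choose c hc using hex
  -- The choice `c` need not be continuous; compatibility of the isotropy groups makes the value
  -- independent of it.
  have key : ∀ t p, φ (c (t +ᵥ s p)) +ᵥ s' (M.proj (t +ᵥ s p)) = φ t +ᵥ s' p := by
    intro t p
    have hp : M.proj (t +ᵥ s p) = p := by rw [M.proj_vadd, hsp]
    have h₁ := hc (t +ᵥ s p)
    rw [hp] at h₁ ⊢
    have h₂ := h p (-t + c (t +ᵥ s p)) (by rw [← vadd_vadd, h₁, neg_vadd_vadd])
    rw [map_add, map_neg, ← vadd_vadd, neg_vadd_eq_iff] at h₂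
    exact h₂
  refine ⟨fun x => φ (c x) +ᵥ s' (M.proj x), ?_, key⟩
  -- The translates of the section form a finite closed cover, and the map is continuous on each of
  -- them.
  refine (locallyFinite_of_finite fun t : ZTwoPow d => range fun p => t +ᵥ s p).continuous
    (eq_univ_of_forall fun x => mem_iUnion.2 ⟨c x, M.proj x, hc x⟩)
    (fun t => (isCompact_range (hs.const_vadd t)).isClosed) fun t => ?_
  have hcont : Continuous fun x => φ t +ᵥ s' (M.proj x) :=
    (hs'.comp M.continuous_proj).const_vadd _
  refine hcont.continuousOn.congr ?_
  rintro _ ⟨p, rfl⟩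
  simpa only [M.proj_vadd, hsp] using key t p

variable {l : ℕ} {n : Fin l → ℕ} {d : ℕ}

theorem exists_continuous_section (M : SmallCover d (simplexProdFacet n)) :
    ∃ s : SimplexProd n → M.carrier, Continuous s ∧ ∀ p, M.proj (s p) = p := by
  obtain ⟨s, hs, hsp⟩ := M.exists_section_interior
  have hd : Dense (SimplexProd.cell ∅ : Set (SimplexProd n)) := fun p =>
    SimplexProd.mem_closure_cell SimplexProd.nonempty_cell_empty (by simp)
  have hlim : ∀ p, ∃ y, Tendsto s (𝓝[SimplexProd.cell ∅] p) (𝓝 y) := fun p =>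
    M.exists_tendsto_section hs hsp (hd p) fun U hU =>
      SimplexProd.exists_mem_nhds_isPreconnected_inter_cell ∅ hU
  refine ⟨extendFrom (SimplexProd.cell ∅) s, continuous_extendFrom hd hlim, fun p => ?_⟩
  refine congrFun (Continuous.ext_on hd
    (M.continuous_proj.comp (continuous_extendFrom hd hlim)) continuous_id fun q hq => ?_) p
  rw [Function.comp_apply, extendFrom_eq (subset_closure hq) (hs q hq)]
  exact hsp q hq

/-- With a section, a small cover is `P × ℤ₂^d` with fibres collapsed by the isotropy groups, so
these groups determine it. The maps built from the sections in both directions are mutually inverse.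
-/
theorem djEquiv_of_stabilizer {M N : SmallCover d (simplexProdFacet n)}
    (φ : ZTwoPow d ≃+ ZTwoPow d)
    (h : ∀ x y, M.proj x = N.proj y → ∀ t, t +ᵥ x = x ↔ φ t +ᵥ y = y) : DJEquiv M N := by
  obtain ⟨s, hs, hsp⟩ := M.exists_continuous_section
  obtain ⟨s', hs', hsp'⟩ := N.exists_continuous_section
  obtain ⟨f, hf, hft⟩ := exists_continuous_of_section hs hs' hsp φ
    fun p t => (h _ _ (by rw [hsp, hsp']) t).1
  obtain ⟨g, hg, hgt⟩ := exists_continuous_of_section hs' hs hsp' φ.symm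
    fun p t ht => (h _ _ (by rw [hsp, hsp']) _).2 (by simpa using ht)
  have hM : ∀ x, ∃ t : ZTwoPow d, t +ᵥ s (M.proj x) = x := fun x =>
    (M.proj_eq_proj_iff _ _).1 (hsp _)
  have hN : ∀ x, ∃ t : ZTwoPow d, t +ᵥ s' (N.proj x) = x := fun x =>
    (N.proj_eq_proj_iff _ _).1 (hsp' _)
  refine ⟨φ, ⟨⟨f, g, fun x => ?_, fun x => ?_⟩, hf, hg⟩, fun t x => ?_, fun x => ?_⟩
  · obtain ⟨t, ht⟩ := hM x
    rw [← ht, hft, hgt, φ.symm_apply_apply]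
  · obtain ⟨t, ht⟩ := hN x
    rw [← ht, hgt, hft, φ.apply_symm_apply]
  · obtain ⟨t', ht⟩ := hM x
    change f _ = _ +ᵥ f _
    rw [← ht, vadd_vadd, hft, hft, map_add, vadd_vadd]
  · obtain ⟨t, ht⟩ := hM x
    change N.proj (f _) = _
    rw [← ht, hft, N.proj_vadd, M.proj_vadd, hsp, hsp']

end SmallCover

/-! ### The group generated by the facets, and its relations. -/

/-- The elementary 2-group generated by the facets of a product of simplices. -/
abbrev FacetGroup {l : ℕ} (n : Fin l → ℕ) : Type := ∀ i : Fin l, Fin (n i + 1) → ZMod 2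

namespace FacetGroup

variable {l : ℕ} {n : Fin l → ℕ}

/-- The elements supported on the facets through `p`. -/
def supported (p : SimplexProd n) : Submodule (ZMod 2) (FacetGroup n) where
  carrier := {u | ∀ i k, SimplexProd.incl p i k ≠ 0 → u i k = 0}
  zero_mem' := fun _ _ _ => rfl
  add_mem' := fun {u v} hu hv i k h => by simp [hu i k h, hv i k h]
  smul_mem' := fun c u hu i k h => by simp [hu i k h]

theorem mem_supported {p : SimplexProd n} {u : FacetGroup n} :
    u ∈ supported p ↔ ∀ i k, SimplexProd.incl p i k ≠ 0 → u i k = 0 := Iff.rfl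

/-- The linear map determined by the images of the facets. -/
def lift {V : Type*} [AddCommGroup V] [Module (ZMod 2) V] (lam : ∀ i : Fin l, Fin (n i + 1) → V) :
    FacetGroup n →ₗ[ZMod 2] V where
  toFun u := ∑ i, ∑ k, u i k • lam i k
  map_add' u v := by simp [add_smul, Finset.sum_add_distrib]
  map_smul' c u := by simp [Finset.smul_sum, mul_smul]

theorem lift_apply {V : Type*} [AddCommGroup V] [Module (ZMod 2) V]
    (lam : ∀ i : Fin l, Fin (n i + 1) → V) (u : FacetGroup n) :
    lift lam u = ∑ i, ∑ k, u i k • lam i k := rfl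

theorem map_lift {V W F : Type*} [AddCommGroup V] [Module (ZMod 2) V] [AddCommGroup W]
    [Module (ZMod 2) W] [FunLike F V W] [AddMonoidHomClass F V W] (φ : F)
    (lam : ∀ i : Fin l, Fin (n i + 1) → V) (u : FacetGroup n) :
    φ (lift lam u) = lift (fun i k => φ (lam i k)) u := by
  simp only [lift_apply, map_sum, ZMod.map_smul]

/-- The generator that belongs to a facet. -/
def gen (i : Fin l) (k : Fin (n i + 1)) : FacetGroup n := Pi.single i (Pi.single k 1)

theorem gen_apply_self (i : Fin l) (k : Fin (n i + 1)) : gen i k i k = 1 := by simp [gen]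

theorem gen_apply_of_ne {i i' : Fin l} {k : Fin (n i + 1)} {k' : Fin (n i' + 1)}
    (h : (⟨i', k'⟩ : Σ i : Fin l, Fin (n i + 1)) ≠ ⟨i, k⟩) : gen i k i' k' = 0 := by
  by_cases hi : i' = i
  · subst hi
    have : k' ≠ k := fun hk => h (by rw [hk])
    simp [gen, this]
  · simp [gen, hi]

theorem gen_ne_zero (i : Fin l) (k : Fin (n i + 1)) : gen i k ≠ 0 := fun h => by
  have := gen_apply_self i k
  rw [h] at this
  exact zero_ne_one this

theorem lift_gen {V : Type*} [AddCommGroup V] [Module (ZMod 2) V]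
    (lam : ∀ i : Fin l, Fin (n i + 1) → V) (i : Fin l) (k : Fin (n i + 1)) :
    lift lam (gen i k) = lam i k := by
  rw [lift_apply, Finset.sum_eq_single i, Finset.sum_eq_single k, gen_apply_self, one_smul]
  · intro k' _ hk'
    rw [gen_apply_of_ne (by simpa using hk'), zero_smul]
  · simp
  · intro i' _ hi'
    exact Finset.sum_eq_zero fun k' _ => by
      rw [gen_apply_of_ne (fun h => hi' (congrArg Sigma.fst h)), zero_smul]
  · simp

theorem gen_mem_supported {p : SimplexProd n} {i : Fin l} {k : Fin (n i + 1)}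
    (h : SimplexProd.incl p i k = 0) : gen i k ∈ supported p := fun i' k' h' => by
  refine gen_apply_of_ne fun he => h' ?_
  obtain ⟨rfl, hk⟩ := Sigma.mk.inj_iff.1 he
  obtain rfl := eq_of_heq hk
  exact h

/-- Extension by zero on the facets with index `0`. -/
def consZero : (∀ i : Fin l, Fin (n i) → ZMod 2) →ₗ[ZMod 2] FacetGroup n where
  toFun w i := Fin.cons 0 (w i)
  map_add' u v := by
    funext i k
    refine Fin.cases ?_ (fun k => ?_) k <;> simp
  map_smul' c u := by
    funext i k
    refine Fin.cases ?_ (fun k => ?_) k <;> simp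

@[simp] theorem consZero_zero (w : ∀ i : Fin l, Fin (n i) → ZMod 2) (i) : consZero w i 0 = 0 := rfl

@[simp] theorem consZero_succ (w : ∀ i : Fin l, Fin (n i) → ZMod 2) (i) (k : Fin (n i)) :
    consZero w i k.succ = w i k := rfl

theorem consZero_injective : Function.Injective (consZero : _ → FacetGroup n) := fun u v h =>
  funext fun i => funext fun k => by simpa using congrFun (congrFun h i) k.succ

theorem consZero_tail {u : FacetGroup n} (h : ∀ i, u i 0 = 0) :
    consZero (fun i k => u i k.succ) = u := by
  funext i k
  refine Fin.cases ?_ (fun k => ?_) k <;> simp [h]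

theorem card_supported (p : SimplexProd n) :
    Nat.card (supported p) = 2 ^ Set.ncard {j | p ∈ simplexProdFacet n j} := by
  classical
  have : Nat.card ({j // p ∈ simplexProdFacet n j} → ZMod 2) =
      2 ^ Set.ncard {j | p ∈ simplexProdFacet n j} := by
    rw [Nat.card_fun, Nat.card_zmod]
    rfl
  rw [← this]
  refine Nat.card_congr
    { toFun := fun u j => u.1 j.1.1 j.1.2
      invFun := fun f => ⟨fun i k => if h : SimplexProd.incl p i k = 0 then f ⟨⟨i, k⟩, h⟩ else 0,
        fun i k h => dif_neg h⟩
      left_inv := fun u => ?_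
      right_inv := fun f => funext fun j => dif_pos j.2 }
  refine Subtype.ext (funext fun i => funext fun k => ?_)
  by_cases hp : SimplexProd.incl p i k = 0
  · exact dif_pos hp
  · exact (dif_neg hp).trans (u.2 i k hp).symm

theorem lift_gen_eq_self (u : FacetGroup n) : lift gen u = u := by
  funext i k
  simp only [lift_apply, Finset.sum_apply, Pi.smul_apply, smul_eq_mul]
  rw [Finset.sum_eq_single i, Finset.sum_eq_single k, gen_apply_self, mul_one]
  · intro k' _ hk'
    rw [gen_apply_of_ne (by simpa using hk'.symm), mul_zero]
  · simp
  · intro i' _ hi'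
    exact Finset.sum_eq_zero fun k' _ => by
      rw [gen_apply_of_ne (fun h => hi' (congrArg Sigma.fst h).symm), mul_zero]
  · simp

end FacetGroup

namespace BlockMatrix

variable {l : ℕ} {n : Fin l → ℕ}

/-- The combinations of the rows of the block matrix, extended by an identity matrix. -/
def rows (A : BlockMatrix n) : (Fin l → ZMod 2) →ₗ[ZMod 2] FacetGroup n where
  toFun c j := Fin.cons (c j) (fun k => ∑ i, c i * A i j k)
  map_add' u v := by
    funext i k
    refine Fin.cases ?_ (fun k => ?_) k <;> simp [add_mul, Finset.sum_add_distrib]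
  map_smul' c u := by
    funext i k
    refine Fin.cases ?_ (fun k => ?_) k <;> simp [mul_assoc, Finset.mul_sum]

@[simp] theorem rows_zero (A : BlockMatrix n) (c) (j) : A.rows c j 0 = c j := rfl

@[simp] theorem rows_succ (A : BlockMatrix n) (c) (j) (k : Fin (n j)) :
    A.rows c j k.succ = ∑ i, c i * A i j k := rfl

theorem rows_eq (A : BlockMatrix n) (c) :
    A.rows c = ∑ i, c i • (FacetGroup.gen i 0 + FacetGroup.consZero (A i)) := by
  funext j k
  simp only [Finset.sum_apply, Pi.smul_apply, Pi.add_apply, smul_eq_mul]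
  refine Fin.cases ?_ (fun k => ?_) k
  · rw [Finset.sum_eq_single j]
    · simp [FacetGroup.gen_apply_self]
    · intro i _ hi
      rw [FacetGroup.gen_apply_of_ne (fun h => hi (congrArg Sigma.fst h).symm)]
      simp
    · simp
  · rw [rows_succ]
    refine Finset.sum_congr rfl fun i _ => ?_
    have hne : (⟨j, k.succ⟩ : Σ i : Fin l, Fin (n i + 1)) ≠ ⟨i, 0⟩ := fun h => by
      obtain ⟨rfl, h⟩ := Sigma.mk.inj_iff.1 h
      exact Fin.succ_ne_zero _ (eq_of_heq h)
    rw [FacetGroup.gen_apply_of_ne hne, zero_add, FacetGroup.consZero_succ]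

theorem rows_single (A : BlockMatrix n) (i : Fin l) :
    A.rows (Pi.single i 1) = FacetGroup.gen i 0 + FacetGroup.consZero (A i) := by
  rw [rows_eq, Finset.sum_eq_single i, Pi.single_eq_same, one_smul]
  · intro j _ hj
    rw [Pi.single_eq_of_ne hj, zero_smul]
  · simp

/-- Each generating row is sent to `lam i 0 + lam i 0 = 0`: the rows are the relations among the
values of `lam`. -/
theorem lift_rows {V : Type*} [AddCommGroup V] [Module (ZMod 2) V] (A : BlockMatrix n)
    {lam : ∀ i : Fin l, Fin (n i + 1) → V}
    (h : ∀ i, lam i 0 = FacetGroup.lift lam (FacetGroup.consZero (A i))) (c) :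
    FacetGroup.lift lam (A.rows c) = 0 := by
  have h2 : ∀ v : V, v + v = 0 := fun v => by
    rw [← one_smul (ZMod 2) v, ← add_smul, CharTwo.add_self_eq_zero, zero_smul]
  simp only [rows_eq, map_sum, map_smul, map_add, FacetGroup.lift_gen, ← h, h2, smul_zero,
    Finset.sum_const_zero]

end BlockMatrix

/-! ### Isotropy groups and the characteristic function. -/

namespace SmallCover

open Topology Set

section

variable {d : ℕ} {P : Type} [TopologicalSpace P] {ι : Type} {F : ι → Set P} (M : SmallCover d F)

theorem isClosed_setOf_fixed [T2Space P] (t : ZTwoPow d) :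
    IsClosed {p | ∃ x : M.carrier, M.proj x = p ∧ t +ᵥ x = x} := by
  have := M.isClosedMap_proj _
    (isClosed_eq (continuous_const_vadd t) (continuous_id (X := M.carrier)))
  convert this using 1
  ext p
  exact ⟨fun ⟨x, h, h'⟩ => ⟨x, h', h⟩, fun ⟨x, h, h'⟩ => ⟨x, h', h⟩⟩

variable {M} in
theorem vadd_eq_self_iff_of_proj_eq {x y : M.carrier} (h : M.proj x = M.proj y) (t : ZTwoPow d) :
    t +ᵥ x = x ↔ t +ᵥ y = y := by
  rw [← AddAction.mem_stabilizer_iff, M.stabilizer_eq_of_proj_eq h, AddAction.mem_stabilizer_iff]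

theorem exists_generator {x : M.carrier} {j : ι} (h : {j : ι | M.proj x ∈ F j} = {j}) :
    ∃ a : ZTwoPow d, a ≠ 0 ∧ ∀ t : ZTwoPow d, t +ᵥ x = x ↔ t = 0 ∨ t = a := by
  have hc := M.card_stabilizer x
  rw [h, Set.ncard_singleton, pow_one, Nat.card_eq_two_iff' 0] at hc
  obtain ⟨a, ha, huniq⟩ := hc
  refine ⟨a.1, fun h => ha (Subtype.ext h), fun t => ⟨fun ht => ?_, ?_⟩⟩
  · by_cases h0 : t = 0
    · exact Or.inl h0
    · exact Or.inr (congrArg Subtype.val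
        (huniq ⟨t, AddAction.mem_stabilizer_iff.2 ht⟩ fun h => h0 (congrArg Subtype.val h)))
  · rintro (rfl | rfl)
    · exact zero_vadd _ x
    · exact AddAction.mem_stabilizer_iff.1 a.2

end

variable {l : ℕ} {n : Fin l → ℕ} {d : ℕ} (M : SmallCover d (simplexProdFacet n))

/-- Fixed-point sets have closed images, so the generator of the order-two isotropy group cannot
jump on the connected relative interior of the facet. -/
theorem exists_facet_generator (hn : ∀ i, 1 ≤ n i) (j : Σ i : Fin l, Fin (n i + 1)) :
    ∃ a : ZTwoPow d, ∀ x : M.carrier, M.proj x ∈ (SimplexProd.cell {j} : Set (SimplexProd n)) →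
      ∀ t : ZTwoPow d, t +ᵥ x = x ↔ t = 0 ∨ t = a := by
  obtain ⟨q, hq⟩ := SimplexProd.nonempty_cell_singleton hn j
  obtain ⟨y, rfl⟩ := M.isQuotientMap_proj.surjective q
  obtain ⟨a, ha0, ha⟩ := M.exists_generator (SimplexProd.mem_cell_iff.1 hq)
  let D : ZTwoPow d → Set (SimplexProd n) := fun t => {p | ∃ x : M.carrier, M.proj x = p ∧ t +ᵥ x = x}
  have hD : ∀ t, IsClosed (D t) := M.isClosed_setOf_fixed
  have hfin : IsClosed (⋃ t ∈ {t : ZTwoPow d | t ≠ 0 ∧ t ≠ a}, D t) :=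
    (Set.toFinite _).isClosed_biUnion fun t _ => hD t
  refine ⟨a, fun x hx t => ?_⟩
  obtain ⟨b, hb0, hb⟩ := M.exists_generator (SimplexProd.mem_cell_iff.1 hx)
  suffices b = a by rw [hb, this]
  by_contra hba
  obtain ⟨p, hp, ⟨z, hz, hz'⟩, hp'⟩ := isPreconnected_closed_iff.1
    (SimplexProd.isPreconnected_cell (n := n) {j}) (D a) _ (hD a) hfin (fun p hp => by
      obtain ⟨z, rfl⟩ := M.isQuotientMap_proj.surjective p
      obtain ⟨c, hc0, hc⟩ := M.exists_generator (SimplexProd.mem_cell_iff.1 hp)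
      by_cases hca : c = a
      · exact Or.inl ⟨z, rfl, hca ▸ (hc c).2 (Or.inr rfl)⟩
      · exact Or.inr (mem_biUnion (show c ∈ {t | t ≠ 0 ∧ t ≠ a} from ⟨hc0, hca⟩)
          ⟨z, rfl, (hc c).2 (Or.inr rfl)⟩))
    ⟨_, hq, y, rfl, (ha a).2 (Or.inr rfl)⟩
    ⟨_, hx, mem_biUnion (show b ∈ {t | t ≠ 0 ∧ t ≠ a} from ⟨hb0, hba⟩)
      ⟨x, rfl, (hb b).2 (Or.inr rfl)⟩⟩
  obtain ⟨s, ⟨hs0, hsa⟩, w, hw, hw'⟩ := mem_iUnion₂.1 hp'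
  obtain ⟨c, hc0, hc⟩ := M.exists_generator (SimplexProd.mem_cell_iff.1 (hz.symm ▸ hp))
  have h₁ := ((hc a).1 hz').resolve_left ha0
  have h₂ := ((hc s).1 ((vadd_eq_self_iff_of_proj_eq (hw.trans hz.symm) s).1 hw')).resolve_left hs0
  exact hsa (h₂.trans h₁.symm)

/-- `lam` is the characteristic function of the small cover: the isotropy group of a point is
generated by the values of `lam` at the facets through its image. -/
def IsCharacteristic (lam : ∀ i : Fin l, Fin (n i + 1) → ZTwoPow d) : Prop :=
  ∀ (x : M.carrier) (t : ZTwoPow d),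
    t +ᵥ x = x ↔ t ∈ (FacetGroup.supported (M.proj x)).map (FacetGroup.lift lam)

theorem standardAct_eq_self_iff {t : ZTwoPow d} {v : EuclideanSpace ℝ (Fin d)} :
    standardAct t v = v ↔ ∀ i, t i = 0 ∨ v i = 0 := by
  constructor
  · intro h i
    have : (standardAct t v) i = v i := by rw [h]
    simp only [standardAct] at this
    by_cases ht : t i = 0
    · exact Or.inl ht
    · rw [if_neg ht] at this
      exact Or.inr (by linarith)
  · intro h
    ext i
    simp only [standardAct]
    rcases h i with h | h
    · rw [if_pos h]
    · simp [h]

/-- Each isotropy group is generated by reflections in facets, seen in a standard chart. -/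
theorem exists_facet_of_chart (lam : ∀ i : Fin l, Fin (n i + 1) → ZTwoPow d)
    (hlam : ∀ i k, ∀ x : M.carrier,
      M.proj x ∈ (SimplexProd.cell {⟨i, k⟩} : Set (SimplexProd n)) →
        ∀ t : ZTwoPow d, t +ᵥ x = x ↔ t = 0 ∨ t = lam i k)
    {x : M.carrier} {θ : ZTwoPow d ≃+ ZTwoPow d}
    {e : OpenPartialHomeomorph M.carrier (EuclideanSpace ℝ (Fin d))} (hx : x ∈ e.source)
    (he : ∀ (t : ZTwoPow d), ∀ y ∈ e.source,
        t +ᵥ y ∈ e.source ∧ e (t +ᵥ y) = standardAct (θ t) (e y))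
    {i : Fin d} (hi : e x i = 0) :
    ∃ j k, SimplexProd.incl (M.proj x) j k = 0 ∧ θ.symm (Pi.single i 1) = lam j k := by
  classical
  have hfix : ∀ y ∈ e.source, ∀ t : ZTwoPow d, t +ᵥ y = y ↔ ∀ m, θ t m = 0 ∨ e y m = 0 := by
    intro y hy t
    rw [← standardAct_eq_self_iff, ← (he t y hy).2]
    exact ⟨fun h => by rw [h], fun h => e.injOn (he t y hy).1 hy h⟩
  -- Points of `U` lie on no facet that misses the image of `x`.
  let U : Set (SimplexProd n) :=
    ⋂ j : {j : Σ i : Fin l, Fin (n i + 1) // SimplexProd.incl (M.proj x) j.1 j.2 ≠ 0},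
      {p | SimplexProd.incl p j.1.1 j.1.2 ≠ 0}
  have hU : IsOpen U := isOpen_iInter_of_finite fun j =>
    isOpen_ne_fun (SimplexProd.continuous_incl_apply _ _) continuous_const
  have hxU : M.proj x ∈ U := mem_iInter.2 fun j => j.2
  have hN : e.target ∩ e.symm ⁻¹' (M.proj ⁻¹' U) ∈ 𝓝 (e x) := by
    refine Filter.inter_mem (e.open_target.mem_nhds (e.map_source hx))
      ((e.continuousAt_symm (e.map_source hx)).preimage_mem_nhds ?_)
    rw [e.left_inv hx]
    exact (hU.preimage M.continuous_proj).mem_nhds hxU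
  -- The `i`-th coordinate stays zero while all other zero coordinates become `ε`, so that near `x`
  -- only the `i`-th reflection remains in the isotropy group.
  let c : ℝ → EuclideanSpace ℝ (Fin d) := fun ε =>
    WithLp.toLp 2 fun m => if m = i then 0 else if e x m = 0 then ε else e x m
  have hc : Continuous c := by
    refine (PiLp.continuous_toLp 2 _).comp (continuous_pi fun m => ?_)
    split_ifs <;> fun_prop
  have hc0 : c 0 = e x := by
    ext m
    simp only [c]
    split_ifs with h₁ h₂
    · rw [h₁, hi]
    · exact h₂.symm
    · rfl
  have hev : ∀ᶠ ε in 𝓝[≠] (0 : ℝ), c ε ∈ e.target ∩ e.symm ⁻¹' (M.proj ⁻¹' U) :=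
    (hc.continuousAt.tendsto.mono_left nhdsWithin_le_nhds) (hc0 ▸ hN)
  obtain ⟨ε, ⟨hεt, hεU⟩, hε⟩ := (hev.and self_mem_nhdsWithin).exists
  have hε0 : ε ≠ 0 := hε
  set y := e.symm (c ε) with hy
  have hys : y ∈ e.source := e.map_target hεt
  have hey : e y = c ε := e.right_inv hεt
  have hyfix : ∀ t : ZTwoPow d, t +ᵥ y = y ↔ ∀ m, m ≠ i → θ t m = 0 := by
    intro t
    rw [hfix y hys, hey]
    refine forall_congr' fun m => ?_
    by_cases hm : m = i
    · simp [hm, c]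
    · have : c ε m ≠ 0 := by
        simp only [c, if_neg hm]
        split_ifs with h
        · exact hε0
        · exact h
      simp [this, hm]
  have h2 : Nat.card (AddAction.stabilizer (ZTwoPow d) y) = 2 := by
    rw [Nat.card_eq_two_iff' 0]
    refine ⟨⟨θ.symm (Pi.single i 1), ?_⟩, ?_, ?_⟩
    · rw [AddAction.mem_stabilizer_iff, hyfix]
      intro m hm
      simp [hm]
    · intro h
      have := congrArg (fun s => θ (Subtype.val s) i) h
      simp at this
    · rintro ⟨t, ht⟩ ht0
      rw [AddAction.mem_stabilizer_iff, hyfix] at ht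
      refine Subtype.ext (θ.injective ?_)
      simp only [AddEquiv.apply_symm_apply]
      have hti : θ t i ≠ 0 := fun h => ht0 (Subtype.ext (θ.injective (funext fun m => by
        by_cases hm : m = i
        · rw [hm, h]; simp
        · rw [ht m hm]; simp)))
      funext m
      by_cases hm : m = i
      · subst hm; simp [ZMod.two_eq_one_of_ne_zero hti]
      · simp [ht m hm, hm]
  -- Isotropy of order two means exactly one facet, and by the choice of `U` it passes through the
  -- image of `x`.
  have h1 : Set.ncard {j | M.proj y ∈ simplexProdFacet n j} = 1 := by
    have := M.card_stabilizer y
    rw [h2] at this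
    exact Nat.pow_right_injective le_rfl (by simpa using this.symm)
  obtain ⟨⟨j, k⟩, hjk⟩ := Set.ncard_eq_one.1 h1
  refine ⟨j, k, ?_, ?_⟩
  · by_contra hne
    have : M.proj y ∈ simplexProdFacet n ⟨j, k⟩ := by
      rw [← Set.mem_ofPred_eq (p := fun j => M.proj y ∈ simplexProdFacet n j), hjk]
      rfl
    exact mem_iInter.1 hεU ⟨⟨j, k⟩, hne⟩ this
  · refine ((hlam j k y (SimplexProd.mem_cell_iff.2 hjk) _).1 ?_).resolve_left ?_
    · rw [hyfix]
      intro m hm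
      simp [hm]
    · intro h
      have := congrArg (fun s => θ s i) h
      simp at this

theorem exists_isCharacteristic (hn : ∀ i, 1 ≤ n i) : ∃ lam, M.IsCharacteristic lam := by
  have hex := fun i k => M.exists_facet_generator hn ⟨i, k⟩
  choose lam hlam using hex
  refine ⟨lam, fun x t => ⟨fun ht => ?_, ?_⟩⟩
  · obtain ⟨θ, e, -, hx, he⟩ := M.locallyStandard x
    have hfix : ∀ m, θ t m = 0 ∨ e x m = 0 := by
      rw [← standardAct_eq_self_iff, ← (he t x hx).2, ht]
    -- In the chart `t` is a product of coordinate reflections, each of which belongs to a facet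
    -- through the image of `x`.
    have hsum : t = ∑ m, θ t m • θ.symm (Pi.single m 1) := by
      apply θ.injective
      rw [map_sum]
      simp only [ZMod.map_smul, AddEquiv.apply_symm_apply]
      exact pi_eq_sum_univ' (θ t)
    rw [hsum]
    refine Submodule.sum_mem _ fun m _ => ?_
    rcases hfix m with h | h
    · rw [h, zero_smul]
      exact Submodule.zero_mem _
    · obtain ⟨j, k, h0, hjk⟩ := M.exists_facet_of_chart lam hlam hx he h
      rw [hjk]
      exact Submodule.smul_mem _ _
        ⟨_, FacetGroup.gen_mem_supported h0, FacetGroup.lift_gen lam j k⟩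
  · have hsupp : ∀ i k, SimplexProd.incl (M.proj x) i k = 0 → lam i k +ᵥ x = x := by
      intro i k h0
      -- Conversely, the image of `x` is a limit of points of the open facet, and being fixed by
      -- `lam i k` is a closed condition.
      have hcl := SimplexProd.mem_closure_cell (SimplexProd.nonempty_cell_singleton hn ⟨i, k⟩)
        (p := M.proj x) (fun i' k' h => by
          obtain ⟨rfl, hk⟩ := Sigma.mk.inj_iff.1 h
          obtain rfl := eq_of_heq hk
          exact h0)
      have hsub := closure_minimal (fun p hp => by
        obtain ⟨z, rfl⟩ := M.isQuotientMap_proj.surjective p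
        exact ⟨z, rfl, (hlam i k z hp _).2 (Or.inr rfl)⟩) (M.isClosed_setOf_fixed (lam i k))
      obtain ⟨z, hz, hz'⟩ := hsub hcl
      exact (vadd_eq_self_iff_of_proj_eq hz _).1 hz'
    rintro ⟨u, hu, rfl⟩
    rw [← AddAction.mem_stabilizer_iff, FacetGroup.lift_apply]
    refine sum_mem fun i _ => sum_mem fun k _ => ?_
    by_cases h : u i k = 0
    · rw [h, zero_smul]; exact zero_mem _
    · rw [ZMod.two_eq_one_of_ne_zero h, one_smul, AddAction.mem_stabilizer_iff]
      refine hsupp i k ?_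
      by_contra hne
      exact h (hu i k hne)

end SmallCover

/-! ### Vertices and the block matrix as a complete invariant. -/

namespace SimplexProd

variable {l : ℕ} {n : Fin l → ℕ}

/-- The vertex which misses exactly the facets with indices `v`. -/
noncomputable def vertex (v : ∀ i, Fin (n i + 1)) : SimplexProd n := fun i =>
  ⟨Pi.single (v i) 1, single_mem_stdSimplex ℝ (v i)⟩

theorem incl_vertex_ne_zero_iff {v : ∀ i, Fin (n i + 1)} {i k} :
    incl (vertex v) i k ≠ 0 ↔ k = v i := by
  by_cases h : k = v i
  · subst h; simp [incl, vertex]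
  · simp [incl, vertex, h]

end SimplexProd

namespace SmallCover

variable {l : ℕ} {n : Fin l → ℕ}

section

variable {d : ℕ} {M : SmallCover d (simplexProdFacet n)}
  {lam : ∀ i : Fin l, Fin (n i + 1) → ZTwoPow d}

/-- `lift lam` maps the elements supported at `p` onto the isotropy group, and both have order `2 ^
k` for `k` facets through `p`; hence it is injective there. -/
theorem IsCharacteristic.eq_zero_of_lift_eq_zero (h : M.IsCharacteristic lam) {p : SimplexProd n}
    {u : FacetGroup n} (hu : u ∈ FacetGroup.supported p) (h0 : FacetGroup.lift lam u = 0) :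
    u = 0 := by
  obtain ⟨x, rfl⟩ := M.isQuotientMap_proj.surjective p
  let g : FacetGroup.supported (M.proj x) → AddAction.stabilizer (ZTwoPow d) x := fun u =>
    ⟨FacetGroup.lift lam u.1, AddAction.mem_stabilizer_iff.2 ((h x _).2 ⟨u.1, u.2, rfl⟩)⟩
  have hsurj : Function.Surjective g := by
    rintro ⟨t, ht⟩
    obtain ⟨u, hu, rfl⟩ := (h x t).1 (AddAction.mem_stabilizer_iff.1 ht)
    exact ⟨⟨u, hu⟩, rfl⟩
  have hinj : Function.Injective g := (hsurj.bijective_of_nat_card_le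
    ((FacetGroup.card_supported _).le.trans (M.card_stabilizer x).ge)).1
  have := @hinj ⟨u, hu⟩ 0 (Subtype.ext (by simpa [g] using h0))
  exact congrArg Subtype.val this

theorem IsCharacteristic.eq_zero_of_vertex (h : M.IsCharacteristic lam)
    (v : ∀ i, Fin (n i + 1)) {u : FacetGroup n} (hu : ∀ i, u i (v i) = 0)
    (h0 : FacetGroup.lift lam u = 0) : u = 0 :=
  h.eq_zero_of_lift_eq_zero (p := SimplexProd.vertex v)
    (fun i k hk => by rw [SimplexProd.incl_vertex_ne_zero_iff.1 hk, hu]) h0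

theorem IsCharacteristic.injective (h : M.IsCharacteristic lam) :
    Function.Injective ((FacetGroup.lift lam).comp FacetGroup.consZero) := by
  rw [injective_iff_map_eq_zero]
  intro w hw
  apply FacetGroup.consZero_injective
  rw [map_zero]
  exact h.eq_zero_of_vertex (fun _ => 0) (fun i => by simp) hw

theorem IsCharacteristic.vadd_eq_self_iff (h : M.IsCharacteristic lam) {i : Fin l}
    {k : Fin (n i + 1)} {x : M.carrier}
    (hx : M.proj x ∈ (SimplexProd.cell {⟨i, k⟩} : Set (SimplexProd n))) (t : ZTwoPow d) :
    t +ᵥ x = x ↔ t = 0 ∨ t = lam i k := by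
  rw [h]
  constructor
  · rintro ⟨u, hu, rfl⟩
    have hu' : u = u i k • FacetGroup.gen i k := by
      funext i' k'
      by_cases hik : (⟨i', k'⟩ : Σ i : Fin l, Fin (n i + 1)) = ⟨i, k⟩
      · obtain ⟨rfl, hk⟩ := Sigma.mk.inj_iff.1 hik
        obtain rfl := eq_of_heq hk
        simp [FacetGroup.gen_apply_self]
      · rw [Pi.smul_apply, Pi.smul_apply, FacetGroup.gen_apply_of_ne hik, smul_zero]
        exact hu i' k' fun h0 => hik ((hx i' k').1 h0)
    rw [hu', map_smul, FacetGroup.lift_gen]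
    by_cases h0 : u i k = 0
    · left; rw [h0, zero_smul]
    · right; rw [ZMod.two_eq_one_of_ne_zero h0, one_smul]
  · rintro (rfl | rfl)
    · exact Submodule.zero_mem _
    · exact ⟨_, FacetGroup.gen_mem_supported ((hx i k).2 rfl), FacetGroup.lift_gen lam i k⟩

theorem IsCharacteristic.ne_zero (hn : ∀ i, 1 ≤ n i) (h : M.IsCharacteristic lam) (i : Fin l)
    (k : Fin (n i + 1)) : lam i k ≠ 0 := by
  obtain ⟨p, hp⟩ := SimplexProd.nonempty_cell_singleton hn ⟨i, k⟩
  intro h0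
  exact FacetGroup.gen_ne_zero i k (h.eq_zero_of_lift_eq_zero
    (FacetGroup.gen_mem_supported ((hp i k).2 rfl)) ((FacetGroup.lift_gen lam i k).trans h0))

/-- The small cover has the block matrix `A` with respect to the basis given by the facets with
nonzero indices. -/
def HasMatrix (M : SmallCover d (simplexProdFacet n)) (A : BlockMatrix n) : Prop :=
  ∃ lam, M.IsCharacteristic lam ∧
    ∀ i, lam i 0 = FacetGroup.lift lam (FacetGroup.consZero (A i))

theorem HasMatrix.isUnitriangular (hn : ∀ i, 1 ≤ n i) {A : BlockMatrix n} (h : M.HasMatrix A) :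
    A.IsUnitriangular := by
  classical
  obtain ⟨lam, hlam, hA⟩ := h
  refine A.isUnitriangular_of_forall_sum_ne_zero hn fun S hS k => ?_
  by_contra! hall
  -- The sum of the rows in `S`, tested at the vertex omitting facet `(k j).succ` for `j ∈ S` and
  -- facet `0` otherwise; vanishing column sums make it a relation supported there.
  let c : Fin l → ZMod 2 := fun i => if i ∈ S then 1 else 0
  have := hlam.eq_zero_of_vertex (fun j => if j ∈ S then (k j).succ else 0) (u := A.rows c)
    (fun j => by
      by_cases hj : j ∈ S
      · simpa [hj, c, Finset.sum_ite_mem] using hall j hj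
      · simp [hj, c]) (A.lift_rows hA c)
  obtain ⟨j, hj⟩ := hS
  have h0 := congrFun (congrFun this j) 0
  simp [c, hj] at h0

theorem HasMatrix.unique (hn : ∀ i, 1 ≤ n i) {N : SmallCover d (simplexProdFacet n)}
    {A A' : BlockMatrix n} (h : M.HasMatrix A) (h' : N.HasMatrix A') (hMN : DJEquiv M N) :
    A = A' := by
  obtain ⟨lam, hlam, hA⟩ := h
  obtain ⟨lam', hlam', hA'⟩ := h'
  obtain ⟨φ, f, hf, hp⟩ := hMN
  -- Over an open facet the only nonzero isotropy element is the value of the characteristic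
  -- function, so `φ` must match the two values.
  have hφ : ∀ i k, lam' i k = φ (lam i k) := by
    intro i k
    obtain ⟨p, hpc⟩ := SimplexProd.nonempty_cell_singleton hn ⟨i, k⟩
    obtain ⟨x, rfl⟩ := M.isQuotientMap_proj.surjective p
    have hx := (hlam.vadd_eq_self_iff hpc (lam i k)).2 (Or.inr rfl)
    have hfx : φ (lam i k) +ᵥ f x = f x := by rw [← hf, hx]
    refine (((hlam'.vadd_eq_self_iff (by rw [hp]; exact hpc) _).1 hfx).resolve_left ?_).symm
    rw [map_eq_zero_iff φ φ.injective]
    exact hlam.ne_zero hn i k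
  funext i
  apply hlam'.injective
  rw [LinearMap.comp_apply, LinearMap.comp_apply, ← hA', hφ, hA, FacetGroup.map_lift,
    ← funext₂ hφ]

end

variable {M N : SmallCover (∑ i, n i) (simplexProdFacet n)}

/-- Independence at the vertex with all indices `0` gives injectivity; with `d = ∑ i, n i` both
sides have the same order. -/
theorem IsCharacteristic.bijective {lam : ∀ i : Fin l, Fin (n i + 1) → ZTwoPow (∑ i, n i)}
    (h : M.IsCharacteristic lam) :
    Function.Bijective ((FacetGroup.lift lam).comp FacetGroup.consZero) := by
  refine h.injective.bijective_of_nat_card_le ?_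
  rw [Nat.card_fun, Nat.card_pi]
  simp [Finset.prod_pow_eq_pow_sum]

variable (M) in
theorem exists_hasMatrix (hn : ∀ i, 1 ≤ n i) : ∃ A, M.HasMatrix A := by
  obtain ⟨lam, hlam⟩ := M.exists_isCharacteristic hn
  have hex := fun i => hlam.bijective.surjective (lam i 0)
  choose A hA using hex
  exact ⟨A, lam, hlam, fun i => (hA i).symm⟩

/-- The automorphism matching the two bases also matches the values at the facets with index `0`,
because these have the same coordinates `A i`. -/
theorem HasMatrix.djEquiv {A : BlockMatrix n} (h : M.HasMatrix A) (h' : N.HasMatrix A) :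
    DJEquiv M N := by
  obtain ⟨lam, hlam, hA⟩ := h
  obtain ⟨lam', hlam', hA'⟩ := h'
  let b := LinearEquiv.ofBijective _ hlam.bijective
  let b' := LinearEquiv.ofBijective _ hlam'.bijective
  let φ := (b.symm.trans b').toAddEquiv
  have hb : ∀ w, φ (FacetGroup.lift lam (FacetGroup.consZero w)) =
      FacetGroup.lift lam' (FacetGroup.consZero w) := fun w => by
    change b' (b.symm (b w)) = b' w
    rw [b.symm_apply_apply]
  have hφ : ∀ i k, φ (lam i k) = lam' i k := by
    intro i k
    refine Fin.cases ?_ (fun k => ?_) k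
    · rw [hA, hA', hb]
    · rw [← FacetGroup.lift_gen lam, ← FacetGroup.lift_gen lam',
        ← FacetGroup.consZero_tail (u := FacetGroup.gen i k.succ), hb]
      intro j
      refine FacetGroup.gen_apply_of_ne fun h => ?_
      obtain ⟨rfl, h⟩ := Sigma.mk.inj_iff.1 h
      exact Fin.succ_ne_zero _ (eq_of_heq h).symm
  refine djEquiv_of_stabilizer φ fun x y hxy t => ?_
  rw [hlam, hlam', hxy, Submodule.mem_map, Submodule.mem_map]
  refine exists_congr fun u => and_congr_right fun _ => ?_
  rw [← funext₂ hφ, ← FacetGroup.map_lift, φ.injective.eq_iff]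

end SmallCover

/-! ### Passing between families of vectors and single vectors. -/

section Flatten

variable {l : ℕ} {n : Fin l → ℕ} {R : Type*}

/-- A family of vectors as a single vector. -/
def flatten (w : ∀ i, Fin (n i) → R) : Fin (∑ i, n i) → R := fun s =>
  w (finSigmaFinEquiv.symm s).1 (finSigmaFinEquiv.symm s).2

/-- The inverse of `flatten`. -/
def unflatten (t : Fin (∑ i, n i) → R) : ∀ i, Fin (n i) → R := fun i k => t (finSigmaFinEquiv ⟨i, k⟩)

@[simp] theorem unflatten_flatten (w : ∀ i, Fin (n i) → R) : unflatten (flatten w) = w := by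
  funext i k
  simp only [unflatten, flatten]
  rw [Equiv.symm_apply_apply]

@[simp] theorem flatten_unflatten (t : Fin (∑ i, n i) → R) : flatten (unflatten t) = t := by
  funext s
  simp only [unflatten, flatten]
  rw [Equiv.apply_symm_apply]

theorem flatten_injective : Function.Injective (flatten : (∀ i, Fin (n i) → R) → _) :=
  Function.LeftInverse.injective unflatten_flatten

theorem unflatten_injective : Function.Injective (unflatten : _ → (∀ i, Fin (n i) → R)) :=
  Function.LeftInverse.injective flatten_unflatten

end Flatten

/-! ### Signs, and the product of `ℓ¹`-spheres, whose quotient by sign changes is the product of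
simplices. -/

/-- The sign `±1` of an element of `ZMod 2`. -/
noncomputable def ZMod.sgn (a : ZMod 2) : ℝ := if a = 0 then 1 else -1

namespace ZMod

@[simp] theorem sgn_zero : sgn 0 = 1 := if_pos rfl

@[simp] theorem abs_sgn (a : ZMod 2) : |sgn a| = 1 := by
  unfold sgn; split_ifs <;> simp

theorem sgn_add (a b : ZMod 2) : sgn (a + b) = sgn a * sgn b := by
  by_cases ha : a = 0
  · simp [ha]
  · by_cases hb : b = 0
    · simp [hb]
    · rw [two_eq_one_of_ne_zero ha, two_eq_one_of_ne_zero hb, CharTwo.add_self_eq_zero]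
      simp [sgn]

theorem eq_zero_of_sgn_pos {a : ZMod 2} (h : 0 < sgn a) : a = 0 := by
  by_contra h0
  rw [sgn, if_neg h0] at h
  linarith

theorem eq_zero_of_sgn_mul_eq_self {a : ZMod 2} {x : ℝ} (hx : x ≠ 0) (h : sgn a * x = x) :
    a = 0 := by
  refine eq_zero_of_sgn_pos ?_
  rw [(mul_eq_right₀ hx).1 h]
  exact one_pos

theorem exists_sgn_mul_pos {x : ℝ} (hx : x ≠ 0) : ∃ a : ZMod 2, 0 < sgn a * x := by
  rcases hx.lt_or_gt with h | h
  · exact ⟨1, by simp [sgn, h]⟩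
  · exact ⟨0, by simpa using h⟩

end ZMod

/-- A product of spheres with respect to the `ℓ¹`-norm. -/
def SphereProd {l : ℕ} (n : Fin l → ℕ) : Type :=
  {z : ∀ i : Fin l, Fin (n i + 1) → ℝ // ∀ i, ∑ k, |z i k| = 1}

namespace SphereProd

open Topology

variable {l : ℕ} {n : Fin l → ℕ}

instance : TopologicalSpace (SphereProd n) := instTopologicalSpaceSubtype

instance : T2Space (SphereProd n) := inferInstanceAs (T2Space (Subtype _))

theorem continuous_apply (i : Fin l) (k : Fin (n i + 1)) :
    Continuous fun z : SphereProd n => z.1 i k :=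
  (_root_.continuous_apply k).comp ((_root_.continuous_apply i).comp continuous_subtype_val)

instance : CompactSpace (SphereProd n) := by
  refine isCompact_iff_compactSpace.1 (Metric.isCompact_of_isClosed_isBounded
    (s := {z : ∀ i : Fin l, Fin (n i + 1) → ℝ | ∀ i, ∑ k, |z i k| = 1}) ?_ ?_)
  · have : {z : ∀ i : Fin l, Fin (n i + 1) → ℝ | ∀ i, ∑ k, |z i k| = 1} =
        ⋂ i, {z | ∑ k, |z i k| = 1} := by ext; simp
    rw [this]
    exact isClosed_iInter fun i => isClosed_eq (by fun_prop) continuous_const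
  · refine (Metric.isBounded_closedBall (x := (0 : ∀ i : Fin l, Fin (n i + 1) → ℝ))
      (r := 1)).subset fun z hz => ?_
    rw [mem_closedBall_zero_iff, pi_norm_le_iff_of_nonneg zero_le_one]
    intro i
    rw [pi_norm_le_iff_of_nonneg zero_le_one]
    intro k
    rw [← hz i, Real.norm_eq_abs]
    exact Finset.single_le_sum (f := fun k => |z i k|) (fun k _ => abs_nonneg _)
      (Finset.mem_univ k)

theorem exists_ne_zero (z : SphereProd n) (i : Fin l) : ∃ k, z.1 i k ≠ 0 := by
  by_contra! h
  have := z.2 i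
  simp [h] at this

noncomputable instance : AddAction (FacetGroup n) (SphereProd n) where
  vadd u z := ⟨fun i k => ZMod.sgn (u i k) * z.1 i k, fun i => by simpa [abs_mul] using z.2 i⟩
  zero_vadd z := Subtype.ext (funext fun i => funext fun k => by
    change ZMod.sgn 0 * _ = _
    simp)
  add_vadd u v z := Subtype.ext (funext fun i => funext fun k => by
    change ZMod.sgn (u i k + v i k) * z.1 i k = ZMod.sgn (u i k) * (ZMod.sgn (v i k) * z.1 i k)
    rw [ZMod.sgn_add, mul_assoc])

theorem vadd_apply (u : FacetGroup n) (z : SphereProd n) (i k) :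
    (u +ᵥ z).1 i k = ZMod.sgn (u i k) * z.1 i k := rfl

instance : ContinuousConstVAdd (FacetGroup n) (SphereProd n) where
  continuous_const_vadd u := by
    refine Continuous.subtype_mk (continuous_pi fun i => continuous_pi fun k => ?_) _
    exact continuous_const.mul (continuous_apply i k)

/-- The absolute values of the coordinates. -/
noncomputable def toSimplexProd (z : SphereProd n) : SimplexProd n := fun i =>
  ⟨fun k => |z.1 i k|, fun _ => abs_nonneg _, z.2 i⟩

theorem incl_toSimplexProd (z : SphereProd n) (i k) :
    SimplexProd.incl z.toSimplexProd i k = |z.1 i k| := rfl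

theorem continuous_toSimplexProd : Continuous (toSimplexProd : SphereProd n → _) := by
  rw [SimplexProd.isEmbedding_incl.continuous_iff]
  exact continuous_pi fun i => continuous_pi fun k => (continuous_apply i k).abs

theorem surjective_toSimplexProd : Function.Surjective (toSimplexProd : SphereProd n → _) := by
  intro p
  refine ⟨⟨SimplexProd.incl p, fun i => ?_⟩, SimplexProd.isEmbedding_incl.injective ?_⟩
  · rw [← SimplexProd.sum_incl p i]
    exact Finset.sum_congr rfl fun k _ => abs_of_nonneg (SimplexProd.incl_nonneg p i k)
  · funext i k
    exact abs_of_nonneg (SimplexProd.incl_nonneg p i k)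

theorem toSimplexProd_eq_iff {z z' : SphereProd n} :
    z.toSimplexProd = z'.toSimplexProd ↔ ∃ u : FacetGroup n, u +ᵥ z = z' := by
  constructor
  · intro h
    have habs : ∀ i k, ∃ a : ZMod 2, ZMod.sgn a * z.1 i k = z'.1 i k := by
      intro i k
      have := congrArg (fun p => SimplexProd.incl p i k) h
      simp only [incl_toSimplexProd] at this
      rcases abs_eq_abs.1 this with h | h
      · exact ⟨0, by simp [h]⟩
      · exact ⟨1, by simp [ZMod.sgn, h]⟩
    choose u hu using habs
    exact ⟨u, Subtype.ext (funext fun i => funext fun k => hu i k)⟩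
  · rintro ⟨u, rfl⟩
    refine SimplexProd.isEmbedding_incl.injective (funext fun i => funext fun k => ?_)
    simp [incl_toSimplexProd, vadd_apply, abs_mul]

theorem vadd_eq_self_iff {u : FacetGroup n} {z : SphereProd n} :
    u +ᵥ z = z ↔ u ∈ FacetGroup.supported z.toSimplexProd := by
  rw [FacetGroup.mem_supported]
  simp only [incl_toSimplexProd, ne_eq, abs_eq_zero]
  constructor
  · intro h i k hk
    exact ZMod.eq_zero_of_sgn_mul_eq_self hk (congrFun (congrFun (congrArg Subtype.val h) i) k)
  · refine fun h => Subtype.ext (funext fun i => funext fun k => ?_)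
    rw [vadd_apply]
    by_cases hk : z.1 i k = 0
    · simp [hk]
    · simp [h i k hk]

end SphereProd

/-! ### The realization of a unitriangular block matrix. -/

namespace BlockMatrix

variable {l : ℕ} {n : Fin l → ℕ} (A : BlockMatrix n)

/-- At a sink `j` of the support of `c`, no other row contributes to block `j`, and the diagonal
block is all ones. The combination is then constantly `c j ≠ 0` on block `j`, whichever position `v
j` selects. -/
theorem IsUnitriangular.eq_zero_of_rows {A : BlockMatrix n} (hA : A.IsUnitriangular)
    (v : ∀ i, Fin (n i + 1)) {c : Fin l → ZMod 2} (h : ∀ j, A.rows c j (v j) = 0) : c = 0 := by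
  by_contra hc
  obtain ⟨i₀, hi₀⟩ := Function.ne_iff.1 hc
  obtain ⟨j, hj, hsink⟩ := hA.2.exists_sink (S := {i | c i ≠ 0}) ⟨i₀, hi₀⟩
  refine hj ?_
  have hrow : ∀ k : Fin (n j + 1), A.rows c j k = c j := by
    intro k
    refine Fin.cases rfl (fun k => ?_) k
    rw [rows_succ, Finset.sum_eq_single j, hA.1 j]
    · simp
    · intro i _ hij
      by_cases hi : c i = 0
      · simp [hi]
      · have h0 : A i j = 0 := by
          by_contra hne
          exact hsink i hi ⟨hij.symm, hne⟩
        simp [h0]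
    · simp
  rw [← hrow (v j), h]

/-- The entries of the row combinations at a vertex. -/
def vertexMap (v : ∀ i, Fin (n i + 1)) : (Fin l → ZMod 2) →ₗ[ZMod 2] (Fin l → ZMod 2) where
  toFun c j := A.rows c j (v j)
  map_add' c c' := by simp only [map_add]; rfl
  map_smul' a c := by simp only [map_smul]; rfl

theorem IsUnitriangular.bijective_vertexMap {A : BlockMatrix n} (hA : A.IsUnitriangular)
    (v : ∀ i, Fin (n i + 1)) : Function.Bijective (A.vertexMap v) :=
  Finite.injective_iff_bijective.1 <| (injective_iff_map_eq_zero _).2 fun _ hc =>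
    hA.eq_zero_of_rows v (congrFun hc)

/-- The linear form of the characteristic function with block matrix `A`. -/
def reduce : FacetGroup n →ₗ[ZMod 2] ZTwoPow (∑ i, n i) where
  toFun u := flatten fun j k => u j k.succ + ∑ i, u i 0 * A i j k
  map_add' u v := by
    funext s
    simp only [flatten, Pi.add_apply, add_mul, Finset.sum_add_distrib]
    ring
  map_smul' c u := by
    funext s
    simp only [flatten, Pi.smul_apply, smul_eq_mul, RingHom.id_apply, mul_add, Finset.mul_sum,
      mul_assoc]

theorem reduce_apply (u : FacetGroup n) :
    A.reduce u = flatten fun j k => u j k.succ + ∑ i, u i 0 * A i j k := rfl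

theorem reduce_consZero (w : ∀ i, Fin (n i) → ZMod 2) :
    A.reduce (FacetGroup.consZero w) = flatten w := by
  simp [reduce_apply]

theorem reduce_rows (c) : A.reduce (A.rows c) = 0 := by
  rw [reduce_apply]
  apply unflatten_injective
  funext j k
  rw [unflatten_flatten]
  simp only [rows_succ, rows_zero]
  exact CharTwo.add_self_eq_zero _

/-- The inclusion of `ℤ₂^d` as the subgroup generated by the facets with nonzero indices. -/
def extend : ZTwoPow (∑ i, n i) →+ FacetGroup n where
  toFun t := FacetGroup.consZero (unflatten t)
  map_zero' := map_zero FacetGroup.consZero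
  map_add' t t' := map_add FacetGroup.consZero (unflatten t) (unflatten t')

theorem extend_apply (t : ZTwoPow (∑ i, n i)) :
    (extend t : FacetGroup n) = FacetGroup.consZero (unflatten t) := rfl

theorem reduce_extend (t) : A.reduce (extend t) = t := by
  rw [extend_apply, reduce_consZero, flatten_unflatten]

/-- `extend` splits `reduce`, and the difference of `u` and its projection is an explicit relation;
in particular the kernel of `reduce` is the range of `rows`. -/
theorem add_extend_reduce (u : FacetGroup n) :
    u + extend (A.reduce u) = A.rows fun i => u i 0 := by
  funext j k
  rw [extend_apply, reduce_apply, unflatten_flatten]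
  simp only [Pi.add_apply]
  refine Fin.cases ?_ (fun k => ?_) k
  · simp
  · rw [FacetGroup.consZero_succ, rows_succ, ← add_assoc, CharTwo.add_self_eq_zero, zero_add]

theorem eq_rows_of_reduce_eq_zero {u : FacetGroup n} (h : A.reduce u = 0) :
    u = A.rows fun i => u i 0 := by
  rw [← A.add_extend_reduce, h, map_zero, add_zero]

/-- Nonzero coordinates of `z`, one per factor, select a vertex at whose positions `u` vanishes.
Thus relations act freely on the product of spheres. -/
theorem IsUnitriangular.eq_zero_of_reduce_eq_zero {A : BlockMatrix n} (hA : A.IsUnitriangular)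
    {z : SphereProd n} {u : FacetGroup n} (hu : u ∈ FacetGroup.supported z.toSimplexProd)
    (h : A.reduce u = 0) : u = 0 := by
  choose v hv using z.exists_ne_zero
  have hr := A.eq_rows_of_reduce_eq_zero h
  rw [hr, hA.eq_zero_of_rows v (c := fun i => u i 0), map_zero]
  intro j
  rw [← hr]
  exact hu j (v j) (by rw [SphereProd.incl_toSimplexProd]; exact abs_ne_zero.2 (hv j))

/-- The subgroup of the relations of the characteristic function. -/
def relations : AddSubgroup (FacetGroup n) := (LinearMap.range A.rows).toAddSubgroup

/-- The quotient of the product of spheres by the relations of the characteristic function. -/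
noncomputable def Realization : Type := Quotient (AddAction.orbitRel A.relations (SphereProd n))

namespace Realization

open Topology

noncomputable instance : TopologicalSpace A.Realization := instTopologicalSpaceQuotient

instance : ContinuousConstVAdd A.relations (SphereProd n) where
  continuous_const_vadd u := continuous_const_vadd (u : FacetGroup n)

instance : T2Space A.Realization :=
  inferInstanceAs (T2Space (Quotient (AddAction.orbitRel A.relations (SphereProd n))))

instance : CompactSpace A.Realization := Quotient.compactSpace

/-- The projection from the product of spheres. -/
noncomputable def mk (z : SphereProd n) : A.Realization := Quotient.mk _ z

variable {A}

theorem surjective_mk : Function.Surjective (mk A) := Quotient.mk_surjective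

theorem continuous_mk : Continuous (mk A) := continuous_quotient_mk'

theorem isOpenMap_mk : IsOpenMap (mk A) := isOpenMap_quotient_mk'_add

theorem mk_eq_iff {z z' : SphereProd n} : mk A z = mk A z' ↔ ∃ c, A.rows c +ᵥ z = z' := by
  refine eq_comm.trans (Quotient.eq.trans ?_)
  rw [AddAction.orbitRel_apply, AddAction.mem_orbit_iff]
  constructor
  · rintro ⟨⟨_, c, rfl⟩, h⟩
    exact ⟨c, h⟩
  · rintro ⟨c, h⟩
    exact ⟨⟨_, c, rfl⟩, h⟩

theorem mk_rows_vadd (c) (z : SphereProd n) : mk A (A.rows c +ᵥ z) = mk A z :=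
  (mk_eq_iff.2 ⟨c, rfl⟩).symm

noncomputable instance : AddAction (FacetGroup n) A.Realization where
  vadd u := Quotient.map (fun z => u +ᵥ z) (by
    rintro _ z ⟨r, rfl⟩
    refine ⟨r, ?_⟩
    change r.1 +ᵥ (u +ᵥ z) = u +ᵥ (r.1 +ᵥ z)
    rw [vadd_vadd, vadd_vadd, add_comm])
  zero_vadd := by
    rintro ⟨z⟩
    exact congrArg (mk A) (zero_vadd _ z)
  add_vadd u v := by
    rintro ⟨z⟩
    exact congrArg (mk A) (add_vadd u v z)

theorem vadd_mk (u : FacetGroup n) (z : SphereProd n) : u +ᵥ mk A z = mk A (u +ᵥ z) := rfl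

noncomputable instance : AddAction (ZTwoPow (∑ i, n i)) A.Realization := AddAction.compHom _ extend

theorem vadd_eq (t : ZTwoPow (∑ i, n i)) (q : A.Realization) : t +ᵥ q = extend t +ᵥ q := rfl

/-- Modulo relations, `u` and `extend (A.reduce u)` agree, so sign changes act on the quotient
through `reduce`. -/
theorem vadd_mk_eq_mk_iff {t : ZTwoPow (∑ i, n i)} {z z' : SphereProd n} :
    t +ᵥ mk A z = mk A z' ↔ ∃ u : FacetGroup n, A.reduce u = t ∧ u +ᵥ z = z' := by
  rw [vadd_eq, vadd_mk, mk_eq_iff]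
  constructor
  · rintro ⟨c, h⟩
    exact ⟨A.rows c + extend t, by rw [map_add, reduce_rows, reduce_extend, zero_add],
      by rw [← vadd_vadd, h]⟩
  · rintro ⟨u, rfl, h⟩
    refine ⟨fun i => u i 0, ?_⟩
    rw [← A.add_extend_reduce, vadd_vadd, add_assoc, ← map_add,
      show A.reduce u + A.reduce u = 0 from funext fun _ => CharTwo.add_self_eq_zero _, map_zero,
      add_zero, h]

/-- The projection onto the product of simplices. -/
noncomputable def proj : A.Realization → SimplexProd n :=
  Quotient.lift SphereProd.toSimplexProd (by
    rintro _ z ⟨r, rfl⟩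
    exact (SphereProd.toSimplexProd_eq_iff.2 ⟨r.1, rfl⟩).symm)

theorem proj_mk (z : SphereProd n) : proj (mk A z) = z.toSimplexProd := rfl

theorem continuous_proj : Continuous (proj : A.Realization → _) :=
  SphereProd.continuous_toSimplexProd.quotient_lift _

theorem isQuotientMap_proj : IsQuotientMap (proj : A.Realization → _) := by
  refine continuous_proj.isClosedMap.isQuotientMap continuous_proj fun p => ?_
  obtain ⟨z, rfl⟩ := SphereProd.surjective_toSimplexProd p
  exact ⟨mk A z, rfl⟩

theorem proj_eq_proj_iff (x y : A.Realization) :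
    proj x = proj y ↔ ∃ t : ZTwoPow (∑ i, n i), t +ᵥ x = y := by
  obtain ⟨z, rfl⟩ := surjective_mk x
  obtain ⟨z', rfl⟩ := surjective_mk y
  simp only [vadd_mk_eq_mk_iff, proj_mk, SphereProd.toSimplexProd_eq_iff]
  exact ⟨fun ⟨u, h⟩ => ⟨_, u, rfl, h⟩, fun ⟨_, u, _, h⟩ => ⟨u, h⟩⟩

theorem vadd_eq_self_iff (x : A.Realization) (t : ZTwoPow (∑ i, n i)) :
    t +ᵥ x = x ↔ t ∈ (FacetGroup.supported (proj x)).map A.reduce := by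
  obtain ⟨z, rfl⟩ := surjective_mk x
  simp only [vadd_mk_eq_mk_iff, SphereProd.vadd_eq_self_iff, Submodule.mem_map, and_comm, proj_mk]

theorem card_stabilizer (hA : A.IsUnitriangular) (x : A.Realization) :
    Nat.card (AddAction.stabilizer (ZTwoPow (∑ i, n i)) x) =
      2 ^ Set.ncard {j | proj x ∈ simplexProdFacet n j} := by
  rw [← FacetGroup.card_supported]
  symm
  refine Nat.card_congr (Equiv.ofBijective (fun u => ⟨A.reduce u.1, AddAction.mem_stabilizer_iff.2
    ((vadd_eq_self_iff x _).2 ⟨u.1, u.2, rfl⟩)⟩) ⟨fun u u' h => ?_, ?_⟩)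
  · obtain ⟨z, rfl⟩ := surjective_mk x
    refine Subtype.ext (sub_eq_zero.1 (hA.eq_zero_of_reduce_eq_zero (sub_mem u.2 u'.2) ?_))
    rw [map_sub, sub_eq_zero]
    exact congrArg Subtype.val h
  · rintro ⟨t, ht⟩
    obtain ⟨u, hu, rfl⟩ := (vadd_eq_self_iff x t).1 (AddAction.mem_stabilizer_iff.1 ht)
    exact ⟨⟨u, hu⟩, rfl⟩

end Realization

end BlockMatrix

/-! ### Affine coordinates on the product of spheres. -/

namespace SphereProd

open Topology

variable {l : ℕ} {n : Fin l → ℕ} (v : ∀ i, Fin (n i + 1))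

/-- Homogeneous coordinates with the coordinates at the vertex `v` equal to `1`. -/
noncomputable def homogenize (x : EuclideanSpace ℝ (Fin (∑ i, n i))) (i : Fin l) :
    Fin (n i + 1) → ℝ :=
  (v i).insertNth (α := fun _ => ℝ) 1 (unflatten x i)

@[simp] theorem homogenize_same (x) (i) : homogenize v x i (v i) = 1 :=
  Fin.insertNth_apply_same (α := fun _ => ℝ) _ _ _

@[simp] theorem homogenize_succAbove (x) (i) (k : Fin (n i)) :
    homogenize v x i ((v i).succAbove k) = unflatten x i k :=
  Fin.insertNth_apply_succAbove (α := fun _ => ℝ) _ _ _ _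

theorem contDiff_homogenize (i) (k : Fin (n i + 1)) :
    ContDiff ℝ ∞ fun x => homogenize v x i k := by
  refine Fin.succAboveCases (v i) ?_ (fun k => ?_) k
  · simp only [homogenize_same]
    exact contDiff_const
  · simp only [homogenize_succAbove, unflatten]
    fun_prop

/-- The affine coordinates of homogeneous coordinates. -/
noncomputable def affine (y : ∀ i, Fin (n i + 1) → ℝ) : EuclideanSpace ℝ (Fin (∑ i, n i)) :=
  WithLp.toLp 2 (flatten fun i k => y i ((v i).succAbove k) / y i (v i))

theorem unflatten_affine (y : ∀ i, Fin (n i + 1) → ℝ) (i) (k : Fin (n i)) :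
    unflatten (affine v y) i k = y i ((v i).succAbove k) / y i (v i) :=
  congrFun (congrFun (unflatten_flatten fun i k => y i ((v i).succAbove k) / y i (v i)) i) k

theorem euclidean_ext {x y : EuclideanSpace ℝ (Fin (∑ i, n i))}
    (h : ∀ i k, unflatten x i k = unflatten y i k) : x = y := by
  ext s
  exact congrFun (unflatten_injective (n := n) (funext fun i => funext (h i))) s

theorem sum_abs_homogenize_pos (x) (i) : 0 < ∑ k, |homogenize v x i k| :=
  Finset.sum_pos' (fun _ _ => abs_nonneg _) ⟨v i, Finset.mem_univ _, by simp⟩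

/-- The point of the product of spheres with given affine coordinates, which is positive at the
vertex `v`. -/
noncomputable def ofAffine (x : EuclideanSpace ℝ (Fin (∑ i, n i))) : SphereProd n :=
  ⟨fun i k => homogenize v x i k / ∑ k, |homogenize v x i k|, fun i => by
    simp only [abs_div, Finset.abs_sum_of_nonneg' (fun _ => abs_nonneg _)]
    rw [← Finset.sum_div]
    exact div_self (sum_abs_homogenize_pos v x i).ne'⟩

theorem ofAffine_apply (x) (i) (k) :
    (ofAffine v x).1 i k = homogenize v x i k / ∑ k, |homogenize v x i k| := rfl

theorem ofAffine_same_pos (x) (i) : 0 < (ofAffine v x).1 i (v i) := by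
  rw [ofAffine_apply, homogenize_same]
  exact one_div_pos.2 (sum_abs_homogenize_pos v x i)

theorem continuous_ofAffine : Continuous (ofAffine v) := by
  refine Continuous.subtype_mk (continuous_pi fun i => continuous_pi fun k => ?_) _
  refine (contDiff_homogenize v i k).continuous.div
    (continuous_finsetSum _ fun k _ => (contDiff_homogenize v i k).continuous.abs)
    fun x => (sum_abs_homogenize_pos v x i).ne'

theorem affine_ofAffine (x) : affine v (ofAffine v x).1 = x := by
  refine euclidean_ext fun i k => ?_
  rw [unflatten_affine, ofAffine_apply, ofAffine_apply,
    div_div_div_cancel_right₀ (sum_abs_homogenize_pos v x i).ne', homogenize_same, div_one,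
    homogenize_succAbove]

theorem homogenize_affine {y : ∀ i, Fin (n i + 1) → ℝ} {i} (hy : y i (v i) ≠ 0) (k) :
    homogenize v (affine v y) i k = y i k / y i (v i) := by
  refine Fin.succAboveCases (v i) ?_ (fun k => ?_) k
  · rw [homogenize_same, div_self hy]
  · rw [homogenize_succAbove, unflatten_affine]

theorem ofAffine_affine {z : SphereProd n} (hz : ∀ i, 0 < z.1 i (v i)) :
    ofAffine v (affine v z.1) = z := by
  refine Subtype.ext (funext fun i => funext fun k => ?_)
  rw [ofAffine_apply]
  simp only [homogenize_affine v (hz i).ne', abs_div]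
  rw [← Finset.sum_div, z.2 i, abs_of_pos (hz i), div_div_div_cancel_right₀ (hz i).ne', div_one]

theorem continuousOn_affine :
    ContinuousOn (fun z : SphereProd n => affine v z.1) {z | ∀ i, 0 < z.1 i (v i)} := by
  refine (PiLp.continuous_toLp 2 _).comp_continuousOn (continuousOn_pi.2 fun s => ?_)
  exact (continuous_apply _ _).continuousOn.div (continuous_apply _ _).continuousOn
    fun z hz => (hz _).ne'

theorem isOpen_setOf_pos : IsOpen {z : SphereProd n | ∀ i, 0 < z.1 i (v i)} := by
  rw [Set.ofPred_forall]
  exact isOpen_iInter_of_finite fun i => isOpen_lt continuous_const (continuous_apply i _)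

theorem isOpenMap_ofAffine : IsOpenMap (ofAffine v) := by
  intro U hU
  convert (continuousOn_affine v).isOpen_inter_preimage (isOpen_setOf_pos v) hU using 1
  ext z
  constructor
  · rintro ⟨x, hx, rfl⟩
    exact ⟨ofAffine_same_pos v x, by rwa [Set.mem_preimage, affine_ofAffine]⟩
  · rintro ⟨hz, hzU⟩
    exact ⟨_, hzU, ofAffine_affine v hz⟩

/-- Sign changes away from the vertex are linear in affine coordinates. -/
theorem vadd_ofAffine {u : FacetGroup n} (hu : ∀ i, u i (v i) = 0) (x) :
    u +ᵥ ofAffine v x =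
      ofAffine v (standardAct (flatten fun i k => u i ((v i).succAbove k)) x) := by
  set x' := standardAct (flatten fun i k => u i ((v i).succAbove k)) x with hx'
  have hpos : ∀ i, 0 < (u +ᵥ ofAffine v x).1 i (v i) := fun i => by
    rw [vadd_apply, hu, ZMod.sgn_zero, one_mul]
    exact ofAffine_same_pos v x i
  rw [← ofAffine_affine v hpos]
  congr 1
  refine euclidean_ext fun i k => ?_
  have h₁ : unflatten x' i k = ZMod.sgn (u i ((v i).succAbove k)) * unflatten x i k := by
    have h₂ : flatten (fun i k => u i ((v i).succAbove k)) (finSigmaFinEquiv ⟨i, k⟩) =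
        u i ((v i).succAbove k) :=
      congrFun (congrFun (unflatten_flatten fun i k => u i ((v i).succAbove k)) i) k
    simp only [hx', unflatten, standardAct, h₂, ZMod.sgn]
    split_ifs <;> simp
  rw [unflatten_affine, vadd_apply, vadd_apply, hu, ZMod.sgn_zero, one_mul, mul_div_assoc,
    ← unflatten_affine, affine_ofAffine, h₁]

end SphereProd

/-! ### Smooth charts and the small cover structure on the realization. -/

namespace BlockMatrix

variable {l : ℕ} {n : Fin l → ℕ} {A : BlockMatrix n}

namespace Realization

open Topology SphereProd

/-- A relation that preserves positivity at all positions `v j` vanishes there, hence is trivial. -/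
theorem mk_ofAffine_injective (hA : A.IsUnitriangular) (v : ∀ i, Fin (n i + 1)) :
    Function.Injective fun x => mk A (ofAffine v x) := by
  intro x y h
  obtain ⟨c, hc⟩ := mk_eq_iff.1 h
  have h0 : c = 0 := hA.eq_zero_of_rows v fun j => by
    have hj := ofAffine_same_pos v y j
    rw [← hc, vadd_apply] at hj
    exact ZMod.eq_zero_of_sgn_pos ((pos_iff_pos_of_mul_pos hj).2 (ofAffine_same_pos v x j))
  rw [h0, map_zero, zero_vadd] at hc
  rw [← affine_ofAffine v x, hc, affine_ofAffine]

theorem isOpenEmbedding_mk_ofAffine (hA : A.IsUnitriangular) (v : ∀ i, Fin (n i + 1)) :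
    IsOpenEmbedding fun x => mk A (ofAffine v x) :=
  .of_continuous_injective_isOpenMap (continuous_mk.comp (continuous_ofAffine v))
    (mk_ofAffine_injective hA v) (isOpenMap_mk.comp (isOpenMap_ofAffine v))

/-- The affine chart at a vertex. -/
noncomputable def chart (hA : A.IsUnitriangular) (v : ∀ i, Fin (n i + 1)) :
    OpenPartialHomeomorph A.Realization (EuclideanSpace ℝ (Fin (∑ i, n i))) :=
  ((isOpenEmbedding_mk_ofAffine hA v).toOpenPartialHomeomorph _).symm

theorem chart_source (hA : A.IsUnitriangular) (v : ∀ i, Fin (n i + 1)) :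
    (chart hA v).source = Set.range fun x => mk A (ofAffine v x) := by
  simp [chart]

theorem chart_mk_ofAffine (hA : A.IsUnitriangular) (v : ∀ i, Fin (n i + 1)) (x) :
    chart hA v (mk A (ofAffine v x)) = x :=
  (isOpenEmbedding_mk_ofAffine hA v).toOpenPartialHomeomorph_left_inv _

theorem exists_mem_chart_source (hA : A.IsUnitriangular) (q : A.Realization) :
    ∃ v, q ∈ (chart hA v).source := by
  obtain ⟨z, rfl⟩ := surjective_mk q
  choose v hv using z.exists_ne_zero
  choose a ha using fun i => ZMod.exists_sgn_mul_pos (hv i)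
  -- Relations realize every sign pattern at `v`, so some representative is positive there.
  obtain ⟨c, hc⟩ := (hA.bijective_vertexMap v).surjective a
  refine ⟨v, ?_⟩
  rw [chart_source]
  refine ⟨affine v (A.rows c +ᵥ z).1, ?_⟩
  change mk A (ofAffine v _) = _
  rw [ofAffine_affine, mk_rows_vadd]
  intro i
  rw [vadd_apply, show A.rows c i (v i) = a i from congrFun hc i]
  exact ha i

/-- The smooth atlas of the affine charts. -/
@[reducible] noncomputable def chartedSpace (hA : A.IsUnitriangular) :
    ChartedSpace (EuclideanSpace ℝ (Fin (∑ i, n i))) A.Realization where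
  atlas := Set.range (chart hA)
  chartAt q := chart hA (exists_mem_chart_source hA q).choose
  mem_chart_source q := (exists_mem_chart_source hA q).choose_spec
  chart_mem_atlas _ := ⟨_, rfl⟩

theorem contDiffOn_transition (hA : A.IsUnitriangular) (v w : ∀ i, Fin (n i + 1)) :
    ContDiffOn ℝ ∞ (fun x => chart hA w (mk A (ofAffine v x)))
      {x | mk A (ofAffine v x) ∈ (chart hA w).source} := by
  intro x₀ hx₀
  refine ContDiffAt.contDiffWithinAt ?_
  rw [Set.mem_ofPred_eq, chart_source] at hx₀
  obtain ⟨y₀, hy₀⟩ := hx₀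
  obtain ⟨c, hc⟩ := mk_eq_iff.1 hy₀.symm
  -- The sign change `c` found at `x₀` serves a whole neighbourhood. Dropping the
  -- `ℓ¹`-normalization, which cancels in affine coordinates, avoids the nonsmooth absolute values.
  let g : EuclideanSpace ℝ (Fin (∑ i, n i)) → ∀ i, Fin (n i + 1) → ℝ := fun x i k =>
    ZMod.sgn (A.rows c i k) * homogenize v x i k
  have hg : ∀ i k, ContDiff ℝ ∞ fun x => g x i k := fun i k =>
    contDiff_const.mul (contDiff_homogenize v i k)
  have hgz : ∀ x i k, (A.rows c +ᵥ ofAffine v x).1 i k = g x i k / ∑ k, |homogenize v x i k| :=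
    fun x i k => by rw [vadd_apply, ofAffine_apply, mul_div_assoc]
  have hpos : ∀ i, 0 < g x₀ i (w i) := fun i => by
    have := ofAffine_same_pos w y₀ i
    rw [← hc, hgz] at this
    exact (div_pos_iff_of_pos_right (sum_abs_homogenize_pos v x₀ i)).1 this
  have hev : ∀ᶠ x in 𝓝 x₀, ∀ i, 0 < g x i (w i) := Filter.eventually_all.2 fun i =>
    (hg i (w i)).continuous.continuousAt.eventually_const_lt (hpos i)
  have heq : ∀ᶠ x in 𝓝 x₀, chart hA w (mk A (ofAffine v x)) = affine w (g x) := by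
    filter_upwards [hev] with x hx
    have hx' : ∀ i, 0 < (A.rows c +ᵥ ofAffine v x).1 i (w i) := fun i => by
      rw [hgz]
      exact div_pos (hx i) (sum_abs_homogenize_pos v x i)
    rw [← mk_rows_vadd c, ← ofAffine_affine w hx', chart_mk_ofAffine]
    refine euclidean_ext fun i k => ?_
    rw [unflatten_affine, unflatten_affine, hgz, hgz,
      div_div_div_cancel_right₀ (sum_abs_homogenize_pos v x i).ne']
  refine ContDiffAt.congr_of_eventuallyEq ?_ heq
  rw [contDiffAt_euclidean]
  intro s
  exact (hg _ _).contDiffAt.div (hg _ _).contDiffAt (hpos _).ne'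

theorem isManifold (hA : A.IsUnitriangular) :
    letI := chartedSpace hA
    IsManifold (modelWithCornersSelf ℝ (EuclideanSpace ℝ (Fin (∑ i, n i)))) ∞ A.Realization := by
  let := chartedSpace hA
  refine isManifold_of_contDiffOn _ _ _ ?_
  rintro _ _ ⟨v, rfl⟩ ⟨w, rfl⟩
  refine (contDiffOn_transition hA v w).mono fun x hx => ?_
  exact (Set.mem_inter_iff _ _ _).1 (hx.1) |>.2

/-- The automorphism by which `ℤ₂^d` acts in the affine chart at a vertex. -/
theorem exists_vertex_automorphism (hA : A.IsUnitriangular) (v : ∀ i, Fin (n i + 1)) :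
    ∃ θ : ZTwoPow (∑ i, n i) ≃+ ZTwoPow (∑ i, n i), ∀ t, ∃ c,
      (∀ i, (extend t + A.rows c) i (v i) = 0) ∧
        θ t = flatten fun i k => (extend t + A.rows c) i ((v i).succAbove k) := by
  let G := LinearEquiv.ofBijective _ (hA.bijective_vertexMap v)
  -- The unique relation that cancels the signs of `extend t` at `v`; the corrected element then
  -- acts linearly in the chart.
  let c : ZTwoPow (∑ i, n i) → Fin l → ZMod 2 := fun t => G.symm fun i => extend t i (v i)
  have hc : ∀ t i, (extend t + A.rows (c t)) i (v i) = 0 := by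
    intro t i
    have : A.rows (c t) i (v i) = extend t i (v i) :=
      congrFun (G.apply_symm_apply fun i => extend t i (v i)) i
    rw [Pi.add_apply, Pi.add_apply, this, CharTwo.add_self_eq_zero]
  have hadd : ∀ t t', c (t + t') = c t + c t' := fun t t' => by
    have h : (fun i => extend (t + t') i (v i)) =
        (fun i => extend t i (v i)) + fun i => extend t' i (v i) := by
      rw [map_add]
      rfl
    simp only [c]
    rw [h, map_add]
  let θ : ZTwoPow (∑ i, n i) →+ ZTwoPow (∑ i, n i) := AddMonoidHom.mk'
    (fun t => flatten fun i k => (extend t + A.rows (c t)) i ((v i).succAbove k)) fun t t' => by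
      rw [map_add, hadd, map_add]
      funext s
      simp only [flatten, Pi.add_apply]
      ring
  have hinj : Function.Injective θ := (injective_iff_map_eq_zero _).2 fun t ht => by
    have hzero : extend t + A.rows (c t) = 0 := by
      funext i k
      refine Fin.succAboveCases (v i) (hc t i) (fun k => ?_) k
      exact congrFun (congrFun (flatten_injective
        (a₁ := fun i k => (extend t + A.rows (c t)) i ((v i).succAbove k))
        (a₂ := fun _ _ => 0) ht) i) k
    have := congrArg A.reduce hzero
    rwa [map_add, reduce_rows, reduce_extend, add_zero, map_zero] at this
  exact ⟨AddEquiv.ofBijective θ (Finite.injective_iff_bijective.1 hinj), fun t =>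
    ⟨c t, hc t, rfl⟩⟩

/-- The realization as a small cover. -/
noncomputable def smallCover (hA : A.IsUnitriangular) :
    SmallCover (∑ i, n i) (simplexProdFacet n) :=
  letI := chartedSpace hA
  haveI := isManifold hA
  { carrier := A.Realization
    locallyStandard := fun q => by
      obtain ⟨v, hv⟩ := exists_mem_chart_source hA q
      obtain ⟨θ, hθ⟩ := exists_vertex_automorphism hA v
      refine ⟨θ, chart hA v, IsManifold.subset_maximalAtlas ⟨v, rfl⟩, hv, fun t y hy => ?_⟩
      rw [chart_source] at hy
      obtain ⟨x, rfl⟩ := hy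
      obtain ⟨c, hc, hθt⟩ := hθ t
      have : t +ᵥ mk A (ofAffine v x) = mk A (ofAffine v (standardAct (θ t) x)) := by
        rw [hθt, ← vadd_ofAffine v hc, vadd_eq, vadd_mk, add_comm, ← vadd_vadd, mk_rows_vadd]
      change t +ᵥ mk A (ofAffine v x) ∈ _ ∧ chart hA v (t +ᵥ mk A (ofAffine v x)) =
        standardAct (θ t) (chart hA v (mk A (ofAffine v x)))
      rw [this, chart_mk_ofAffine, chart_mk_ofAffine, chart_source]
      exact ⟨⟨_, rfl⟩, rfl⟩
    proj := proj
    isQuotientMap_proj := isQuotientMap_proj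
    proj_eq_proj_iff := proj_eq_proj_iff
    card_stabilizer := card_stabilizer hA }

theorem hasMatrix_smallCover (hA : A.IsUnitriangular) : (smallCover hA).HasMatrix A := by
  -- The characteristic function of the realization is `reduce` on the generators, and its linear
  -- extension is `reduce` itself.
  have hlift : FacetGroup.lift (fun i k => A.reduce (FacetGroup.gen i k)) = A.reduce :=
    LinearMap.ext fun u => by rw [← FacetGroup.map_lift, FacetGroup.lift_gen_eq_self]
  refine ⟨fun i k => A.reduce (FacetGroup.gen i k), fun x t => ?_, fun i => ?_⟩
  · rw [hlift]
    exact vadd_eq_self_iff x t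
  · have h := A.reduce_rows (Pi.single i 1)
    rw [rows_single, map_add] at h
    rw [hlift]
    have h2 : A.reduce (FacetGroup.consZero (A i)) + A.reduce (FacetGroup.consZero (A i)) = 0 :=
      funext fun _ => CharTwo.add_self_eq_zero _
    exact add_right_cancel (h.trans h2.symm)

end Realization

end BlockMatrix

theorem mainTheorem3 (l : ℕ) (n : Fin l → ℕ) (hn : ∀ i, 1 ≤ n i) :
    numDJClasses (∑ i, n i) (simplexProdFacet n) =
      ∑ G ∈ acyclicDigraphs l, ∏ i, (2 ^ n i - 1) ^ G.outdeg i := by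
  rw [← BlockMatrix.card_isUnitriangular, numDJClasses]
  symm
  refine Nat.card_congr (Equiv.ofBijective (fun A => Quotient.mk _
    (BlockMatrix.Realization.smallCover A.2)) ⟨fun A A' h => Subtype.ext ?_, fun q => ?_⟩)
  · exact (BlockMatrix.Realization.hasMatrix_smallCover A.2).unique hn
      (BlockMatrix.Realization.hasMatrix_smallCover A'.2) (Quotient.exact h)
  · induction q using Quotient.inductionOn with
    | h M =>
      obtain ⟨A, hA⟩ := M.exists_hasMatrix hn
      exact ⟨⟨A, hA.isUnitriangular hn⟩, Quotient.sound
        ((BlockMatrix.Realization.hasMatrix_smallCover _).djEquiv hA)⟩
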